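/- Let $d\ge 0$ be an integer and let $E=\{e_1,\dots ,e_d\}$ be an ordered basis of $\mathbf R^d$. Let $e_1',\dots ,e_d'$ be its dual basis, given by $\langle e_j,e_k'\rangle =2\pi \delta _{jk}$, and let $\Lambda _E=\mathbf Z e_1+\cdots +\mathbf Z e_d$ and $\Lambda _E'=\mathbf Z e_1'+\cdots +\mathbf Z e_d'$. For $f$ in the Schwartz space $\mathscr S(\mathbf R^d)$ the Zak transform of $f$ is $$ (Z_Ef)(x,\xi )=\sum _{j\in \Lambda _E} f(x-j)e^{i\langle j,\xi \rangle},\qquad x,\xi \in \mathbf R^d, $$ where the series converges absolutely. A function $F$ on $\mathbf R^{2d}$ is called quasi-periodic of order $E$ if $$ F(x+k,\xi )=e^{i\langle k,\xi \rangle}F(x,\xi ) \quad\text{and}\quad F(x,\xi +\kappa )=F(x,\xi ), \qquad k\in \Lambda _E,\ \kappa \in \Lambda _E', $$ and a tempered distribution $F\in \mathscr S'(\mathbf R^{2d})$ is called quasi-periodic of order $E$ if these identities hold in the sense of distributions. Equip $C^\infty (\mathbf R^{2d})$ with its usual topology of locally uniform convergence of all derivatives, and subsets with the subspace topology. Equip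 the spaces of tempered distributions $\mathscr S'(\mathbf R^d)$ and $\mathscr S'(\mathbf R^{2d})$ either both with the weak-$*$ topology or both with the strong dual topology. Regard functions as distributions through integration against test functions. Then the following is true. 1. $Z_E$ is a homeomorphism from $\mathscr S(\mathbf R^d)$ onto the set of quasi-periodic elements of order $E$ in $C^\infty (\mathbf R^{2d})$. 2. For each of the two choices of topology there is a linear homeomorphism from $\mathscr S'(\mathbf R^d)$ onto the set of quasi-periodic elements of order $E$ in $\mathscr S'(\mathbf R^{2d})$ that agrees with $Z_E$ on $\mathscr S(\mathbf R^d)$, and it is the only continuous map from $\mathscr S'(\mathbf R^d)$ to $\mathscr S'(\mathbf R^{2d})$ that agrees with $Z_E$ on $\mathscr S(\mathbf R^d)$. -/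

import Mathlib

open MeasureTheory SchwartzMap
open scoped ContDiff

noncomputable section

namespace ZakTransform

/-- The Euclidean space of dimension `d`. -/
abbrev Space (d : ℕ) : Type := EuclideanSpace ℝ (Fin d)

/-- The phase space of points `(x, ξ)`, of dimension `2 * d`. Its norm is equivalent to the
Euclidean one and its volume is Lebesgue measure. -/
abbrev Phase (d : ℕ) : Type := Space d × Space d

/-! ### Smooth functions with the usual Fréchet topology -/

/-- Complex-valued smooth functions on a real normed space. -/
@[ext]
structure SmoothFunction (W : Type*) [NormedAddCommGroup W] [NormedSpace ℝ W] where
  /-- The underlying function. -/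
  toFun : W → ℂ
  contDiff' : ContDiff ℝ ∞ toFun

namespace SmoothFunction

variable {W : Type*} [NormedAddCommGroup W] [NormedSpace ℝ W]

instance : FunLike (SmoothFunction W) W ℂ where
  coe := toFun
  coe_injective _ _ h := SmoothFunction.ext h

theorem contDiff (F : SmoothFunction W) : ContDiff ℝ ∞ (F : W → ℂ) := F.contDiff'

/-- The `n`-th total derivative of a smooth function, as a continuous map. -/
def derivMap (n : ℕ) (F : SmoothFunction W) : C(W, W [×n]→L[ℝ] ℂ) where
  toFun := iteratedFDeriv ℝ n F
  continuous_toFun := F.contDiff.continuous_iteratedFDeriv (by exact_mod_cast le_top)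

/-- The topology of uniform convergence on compact sets of all derivatives: the coarsest one for
which every `derivMap n` is continuous into the compact-open topology. -/
instance : TopologicalSpace (SmoothFunction W) :=
  ⨅ n : ℕ, TopologicalSpace.induced (derivMap n) inferInstance

end SmoothFunction

/-! ### Lattices -/

variable {d : ℕ}

/-- The lattice of integer linear combinations of a family of vectors. -/
def lattice (e : Fin d → Space d) : Submodule ℤ (Space d) :=
  Submodule.span ℤ (Set.range e)

/-- The dual basis `e'_1, …, e'_d`, determined by `⟪e_j, e'_k⟫ = 2 π δ_{jk}`; see `inner_dualBasis`
and `eq_dualBasis`. -/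
def dualBasis (E : Module.Basis (Fin d) ℝ (Space d)) (k : Fin d) : Space d :=
  (2 * Real.pi) •
    (InnerProductSpace.toDual ℝ (Space d)).symm (LinearMap.toContinuousLinearMap (E.coord k))

theorem inner_dualBasis (E : Module.Basis (Fin d) ℝ (Space d)) (j k : Fin d) :
    inner ℝ (E j) (dualBasis E k) = if j = k then 2 * Real.pi else 0 := by
  rw [dualBasis, inner_smul_right, real_inner_comm, InnerProductSpace.toDual_symm_apply]
  simp [Finsupp.single_apply]

theorem eq_dualBasis (E : Module.Basis (Fin d) ℝ (Space d)) (k : Fin d) (v : Space d)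
    (hv : ∀ j, inner ℝ (E j) v = if j = k then 2 * Real.pi else 0) : v = dualBasis E k := by
  refine InnerProductSpace.ext_inner_left_basis E fun j => ?_
  rw [hv, inner_dualBasis]

/-- The dual lattice, spanned over the integers by the dual basis. -/
def dualLattice (E : Module.Basis (Fin d) ℝ (Space d)) : Submodule ℤ (Space d) :=
  lattice (dualBasis E)

/-! ### The Zak transform and quasi-periodicity -/

/-- The exponential `e^{i ⟪k, ξ⟫}`. -/
def character (k ξ : Space d) : ℂ := Complex.exp (Complex.I * (inner ℝ k ξ : ℝ))

/-- The term of index `j` of the series that defines the Zak transform. -/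
def zakTerm (f : Space d → ℂ) (x ξ : Space d) (j : Space d) : ℂ := f (x - j) * character j ξ

/-- The Zak transform of `f` with respect to `E`, as a function on phase space. -/
def zak (E : Module.Basis (Fin d) ℝ (Space d)) (f : Space d → ℂ) (p : Phase d) : ℂ :=
  ∑' j : lattice E, zakTerm f p.1 p.2 j

/-- Quasi-periodicity of order `E` of a function on phase space. -/
def IsQuasiPeriodic (E : Module.Basis (Fin d) ℝ (Space d)) (F : Phase d → ℂ) : Prop :=
  (∀ k ∈ lattice E, ∀ x ξ, F (x + k, ξ) = character k ξ * F (x, ξ)) ∧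
  (∀ κ ∈ dualLattice E, ∀ x ξ, F (x, ξ + κ) = F (x, ξ))

theorem hasTemperateGrowth_exp :
    (fun t : ℝ => Complex.exp (Complex.I * t)).HasTemperateGrowth := by
  have hs : ContDiff ℝ ∞ (fun t : ℝ => Complex.exp (Complex.I * t)) :=
    (contDiff_const.mul Complex.ofRealCLM.contDiff).cexp
  refine ⟨hs, fun n => ⟨0, 1, fun t => ?_⟩⟩
  have key : ∀ n : ℕ, iteratedDeriv n (fun t : ℝ => Complex.exp (Complex.I * t)) =
      fun t : ℝ => Complex.I ^ n * Complex.exp (Complex.I * t) := by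
    intro n
    induction n with
    | zero => simp
    | succ n ih =>
      rw [iteratedDeriv_succ, ih]
      funext t
      have h1 : HasDerivAt (fun t : ℝ => Complex.I * (t : ℂ)) Complex.I t := by
        simpa using (Complex.ofRealCLM.hasDerivAt (x := t)).const_mul Complex.I
      rw [(h1.cexp.const_mul (Complex.I ^ n)).deriv]
      ring
  rw [norm_iteratedFDeriv_eq_norm_iteratedDeriv, key]
  simp [mul_comm Complex.I, Complex.norm_exp_ofReal_mul_I]

/-- The exponential depends on `(x, ξ)` with temperate growth, so multiplication by it is a
well-defined operator on Schwartz functions. -/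
theorem hasTemperateGrowth_character (k : Space d) :
    (fun p : Phase d => character k p.2).HasTemperateGrowth := by
  have h2 : (fun p : Phase d => (inner ℝ k p.2 : ℝ)).HasTemperateGrowth :=
    ((innerSL ℝ k).comp (ContinuousLinearMap.snd ℝ (Space d) (Space d))).hasTemperateGrowth
  exact hasTemperateGrowth_exp.comp h2

/-- The Schwartz function `(x, ξ) ↦ e^{i ⟪k, ξ⟫} Φ(x, ξ)`. -/
def modulate (k : Space d) : 𝓢(Phase d, ℂ) →L[ℂ] 𝓢(Phase d, ℂ) :=
  SchwartzMap.smulLeftCLM ℂ (fun p : Phase d => character k p.2)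

theorem modulate_apply (k : Space d) (Φ : 𝓢(Phase d, ℂ)) (x ξ : Space d) :
    modulate k Φ (x, ξ) = character k ξ * Φ (x, ξ) := by
  simp [modulate, SchwartzMap.smulLeftCLM_apply_apply (hasTemperateGrowth_character k)]

/-- Quasi-periodicity of order `E` of a functional `u` on Schwartz functions, that is, of
`u(x + k, ξ) = e^{i ⟪k, ξ⟫} u(x, ξ)` and `u(x, ξ + κ) = u(x, ξ)` in the sense of distributions: the
translate of `u` is tested against `Φ` by testing `u` against the opposite translate of `Φ`, and
the product of `u` with the exponential by testing `u` against the product of `Φ` with it. -/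
def IsQuasiPeriodicFunctional (E : Module.Basis (Fin d) ℝ (Space d)) (u : 𝓢(Phase d, ℂ) → ℂ) :
    Prop :=
  (∀ k ∈ lattice E, ∀ Φ : 𝓢(Phase d, ℂ),
    u (SchwartzMap.compSubConstCLM ℂ ((k, 0) : Phase d) Φ) = u (modulate k Φ)) ∧
  (∀ κ ∈ dualLattice E, ∀ Φ : 𝓢(Phase d, ℂ),
    u (SchwartzMap.compSubConstCLM ℂ ((0, κ) : Phase d) Φ) = u Φ)

/-- The quasi-periodic smooth functions on phase space, with the subspace topology. -/
abbrev QuasiPeriodicSmooth (E : Module.Basis (Fin d) ℝ (Space d)) : Type :=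
  {F : SmoothFunction (Phase d) // IsQuasiPeriodic E F}

/-- The quasi-periodic tempered distributions on phase space; the topology is the subspace topology
from the weak-star topology. -/
def quasiPeriodicWeak (E : Module.Basis (Fin d) ℝ (Space d)) :
    Submodule ℂ 𝓢'(Phase d, ℂ) where
  carrier := {u | IsQuasiPeriodicFunctional E u}
  zero_mem' := ⟨fun _ _ _ => rfl, fun _ _ _ => rfl⟩
  add_mem' {_ _} hu hv :=
    ⟨fun k hk Φ => congrArg₂ (· + ·) (hu.1 k hk Φ) (hv.1 k hk Φ),
      fun κ hκ Φ => congrArg₂ (· + ·) (hu.2 κ hκ Φ) (hv.2 κ hκ Φ)⟩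
  smul_mem' c _ hu :=
    ⟨fun k hk Φ => congrArg (c • ·) (hu.1 k hk Φ), fun κ hκ Φ => congrArg (c • ·) (hu.2 κ hκ Φ)⟩

/-- The quasi-periodic tempered distributions on phase space; the topology is the subspace topology
from the strong dual topology, of uniform convergence on bounded sets of Schwartz functions. -/
def quasiPeriodicStrong (E : Module.Basis (Fin d) ℝ (Space d)) :
    Submodule ℂ (StrongDual ℂ 𝓢(Phase d, ℂ)) where
  carrier := {u | IsQuasiPeriodicFunctional E u}
  zero_mem' := ⟨fun _ _ _ => rfl, fun _ _ _ => rfl⟩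
  add_mem' {_ _} hu hv :=
    ⟨fun k hk Φ => congrArg₂ (· + ·) (hu.1 k hk Φ) (hv.1 k hk Φ),
      fun κ hκ Φ => congrArg₂ (· + ·) (hu.2 κ hκ Φ) (hv.2 κ hκ Φ)⟩
  smul_mem' c _ hu :=
    ⟨fun k hk Φ => congrArg (c • ·) (hu.1 k hk Φ), fun κ hκ Φ => congrArg (c • ·) (hu.2 κ hκ Φ)⟩

/-- The functional `u` on Schwartz functions is the one given by integration against the function
`g`. This is how functions are regarded as distributions. -/
def IsGivenBy {W : Type*} [NormedAddCommGroup W] [NormedSpace ℝ W] [MeasureSpace W]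
    (u : 𝓢(W, ℂ) → ℂ) (g : W → ℂ) : Prop :=
  ∀ Φ : 𝓢(W, ℂ), Integrable (fun w => g w * Φ w) ∧ u Φ = ∫ w, g w * Φ w

end ZakTransform

end

/-! For fixed `x` the function `Z f(x, ·)` is a Fourier series whose coefficients are the values of
`f` on `x` plus the lattice, so `f(x)` is the mean of `Z f(x, ·)` over a dual cell. To stay within
smooth functions, cells are replaced by compactly supported partitions of unity: `χ` for the lattice
in `x`, `ψ` for the dual lattice in `ξ`. The candidate inverse is `f(x) = (∫ψ)⁻¹ ∫ ψ(ξ) F(x, ξ) dξ`.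
Quasi-periodicity rewrites this integral as `∑ₘ ∫ e^{i⟪m, ξ⟫} Φ(x - m, ξ) dξ` with `Φ = χ ψ F`
(`zakAverage_of_isQuasiPeriodic`). Here `Φ` depends continuously on `F`, and the sum is a continuous
operator on Schwartz functions because partial Fourier transforms decay rapidly in `m`. Hence the
inverse takes Schwartz values and is continuous. Orthogonality of characters gives one composition;
Poisson summation (`fourierSeries_eq_periodization`) gives the other, since the Fourier series of
the periodization of `ψ F(x, ·)` is `F(x, ·)`.

On distributions the transform is `u ↦ u ∘ Zᵗ`, where `Zᵗ` is the same average up to a reflection in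
`ξ`. It has the right inverse `transposeLift`, a multiple of `θ Z` with `θ = χ ⊗ ψ`, up to the same
reflection. The other composition, lift after `Zᵗ`, quasi-periodizes a test function and cuts it off
by `θ`. A quasi-periodic `u` does not see the difference: in each term the shift moves from the test
function to `θ`, and the translates of `θ` add up to one (`transposeLift_transposeZak`). Both maps
of distributions are transposes of continuous operators, hence continuous for either topology.

Uniqueness is density of functions in the strong dual. The identity of the Schwartz space is a
rapidly convergent series of operators `f ↦ (∫ a f) c` (`exists_rank_one_series`); composing with
`u` approximates `u` by functions, uniformly on bounded sets.

All series are handled by one principle: operators that decay faster than every power of a weight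
with a summable power sum to a continuous operator (`RapidlyDecreasing.exists_sum`), and
polynomially growing factors do no harm. -/

noncomputable section

namespace ZakTransform

section

/-! ### Families of operators on Schwartz functions -/

section Families

variable {ι κ V W X F G H : Type*}
  [NormedAddCommGroup V] [NormedSpace ℝ V] [NormedAddCommGroup W] [NormedSpace ℝ W]
  [NormedAddCommGroup X] [NormedSpace ℝ X]
  [NormedAddCommGroup F] [NormedSpace ℝ F] [NormedSpace ℂ F] [SMulCommClass ℝ ℂ F]
  [NormedAddCommGroup G] [NormedSpace ℝ G] [NormedSpace ℂ G] [SMulCommClass ℝ ℂ G]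
  [NormedAddCommGroup H] [NormedSpace ℝ H] [NormedSpace ℂ H] [SMulCommClass ℝ ℂ H]

/-- A family of operators that decreases faster than every power of the weight `s`, uniformly in
terms of the Schwartz seminorms. -/
def RapidlyDecreasing (s : ι → ℝ) (A : ι → 𝓢(V, F) →L[ℂ] 𝓢(W, G)) : Prop :=
  ∀ N k n : ℕ, ∃ (I : Finset (ℕ × ℕ)) (C : ℝ), 0 ≤ C ∧ ∀ i f,
    s i ^ N * SchwartzMap.seminorm ℂ k n (A i f) ≤ C * I.sup (schwartzSeminormFamily ℂ V F) f

/-- A family of operators that grows at most like a power of the weight `s`. -/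
def TemperatelyGrowing (s : ι → ℝ) (A : ι → 𝓢(V, F) →L[ℂ] 𝓢(W, G)) : Prop :=
  ∀ k n : ℕ, ∃ (N : ℕ) (I : Finset (ℕ × ℕ)) (C : ℝ), 0 ≤ C ∧ ∀ i f,
    SchwartzMap.seminorm ℂ k n (A i f) ≤
      C * s i ^ N * I.sup (schwartzSeminormFamily ℂ V F) f

/-- A weight that is at least one and has a summable negative power. -/
structure IsSummableWeight (s : ι → ℝ) : Prop where
  one_le : ∀ i, 1 ≤ s i
  summable : ∃ N : ℕ, Summable fun i => (s i ^ N)⁻¹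

theorem RapidlyDecreasing.sup {s : ι → ℝ} {A : ι → 𝓢(V, F) →L[ℂ] 𝓢(W, G)}
    (hA : RapidlyDecreasing s A) (hs : ∀ i, 0 ≤ s i) (N : ℕ) (J : Finset (ℕ × ℕ)) :
    ∃ (I : Finset (ℕ × ℕ)) (C : ℝ), 0 ≤ C ∧ ∀ i f,
      s i ^ N * J.sup (schwartzSeminormFamily ℂ W G) (A i f) ≤
        C * I.sup (schwartzSeminormFamily ℂ V F) f := by
  classical
  choose I C hC h using hA N
  refine ⟨J.biUnion fun p => I p.1 p.2, ∑ p ∈ J, C p.1 p.2,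
    Finset.sum_nonneg fun p _ => hC _ _, fun i f => ?_⟩
  have h1 : J.sup (schwartzSeminormFamily ℂ W G) (A i f) ≤
      ∑ p ∈ J, SchwartzMap.seminorm ℂ p.1 p.2 (A i f) := by
    refine Seminorm.finset_sup_apply_le (Finset.sum_nonneg fun p _ => apply_nonneg _ _) ?_
    exact fun p hp => Finset.single_le_sum
      (f := fun p : ℕ × ℕ => SchwartzMap.seminorm ℂ p.1 p.2 (A i f))
      (fun _ _ => apply_nonneg _ _) hp
  calc s i ^ N * J.sup (schwartzSeminormFamily ℂ W G) (A i f)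
      ≤ s i ^ N * ∑ p ∈ J, SchwartzMap.seminorm ℂ p.1 p.2 (A i f) :=
        mul_le_mul_of_nonneg_left h1 (pow_nonneg (hs i) N)
    _ = ∑ p ∈ J, s i ^ N * SchwartzMap.seminorm ℂ p.1 p.2 (A i f) := Finset.mul_sum ..
    _ ≤ ∑ p ∈ J, C p.1 p.2 *
          (J.biUnion fun p => I p.1 p.2).sup (schwartzSeminormFamily ℂ V F) f := by
        refine Finset.sum_le_sum fun p hp => (h p.1 p.2 i f).trans ?_
        refine mul_le_mul_of_nonneg_left ?_ (hC _ _)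
        exact Seminorm.le_def.1 (Finset.sup_mono
          (Finset.subset_biUnion_of_mem (fun p : ℕ × ℕ => I p.1 p.2) hp)) f
    _ = _ := by rw [Finset.sum_mul]

/-- The growth of order `M` of `B` is paid for by asking `A` for decay of order `N + M`. -/
theorem TemperatelyGrowing.comp_rapid {s : ι → ℝ} {B : ι → 𝓢(W, G) →L[ℂ] 𝓢(X, H)}
    {A : ι → 𝓢(V, F) →L[ℂ] 𝓢(W, G)} (hB : TemperatelyGrowing s B) (hA : RapidlyDecreasing s A)
    (hs : ∀ i, 0 ≤ s i) : RapidlyDecreasing s fun i => (B i).comp (A i) := by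
  intro N k n
  obtain ⟨M, J, C, hC, hB⟩ := hB k n
  obtain ⟨I, D, hD, hA⟩ := hA.sup hs (N + M) J
  refine ⟨I, C * D, mul_nonneg hC hD, fun i f => ?_⟩
  calc s i ^ N * SchwartzMap.seminorm ℂ k n (B i (A i f))
      ≤ s i ^ N * (C * s i ^ M * J.sup (schwartzSeminormFamily ℂ W G) (A i f)) :=
        mul_le_mul_of_nonneg_left (hB i _) (pow_nonneg (hs i) N)
    _ = C * (s i ^ (N + M) * J.sup (schwartzSeminormFamily ℂ W G) (A i f)) := by
        rw [pow_add]; ring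
    _ ≤ C * (D * I.sup (schwartzSeminormFamily ℂ V F) f) :=
        mul_le_mul_of_nonneg_left (hA i f) hC
    _ = _ := by ring

theorem exists_sup_bound (L : 𝓢(V, F) →L[ℂ] 𝓢(W, G)) (J : Finset (ℕ × ℕ)) :
    ∃ (I : Finset (ℕ × ℕ)) (C : ℝ), 0 ≤ C ∧ ∀ f, J.sup (schwartzSeminormFamily ℂ W G) (L f) ≤
      C * I.sup (schwartzSeminormFamily ℂ V F) f := by
  have hc : Continuous ((J.sup (schwartzSeminormFamily ℂ W G)).comp L.toLinearMap) := by
    have h1 : Continuous ⇑(J.sup (schwartzSeminormFamily ℂ W G)) :=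
      Seminorm.continuous_finsetSup fun i _ =>
        (schwartz_withSeminorms ℂ W G).continuous_seminorm i
    exact h1.comp L.continuous
  obtain ⟨I, C, -, h⟩ := Seminorm.bound_of_continuous (schwartz_withSeminorms ℂ V F) _ hc
  exact ⟨I, C, C.2, fun f => h f⟩

theorem temperatelyGrowing_const {s : ι → ℝ} (L : 𝓢(V, F) →L[ℂ] 𝓢(W, G)) :
    TemperatelyGrowing s fun _ => L := by
  intro k n
  obtain ⟨I, C, hC, h⟩ := exists_sup_bound L {(k, n)}
  exact ⟨0, I, C, hC, fun i f => by simpa using h f⟩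

theorem RapidlyDecreasing.reindex {s : ι → ℝ} {A : ι → 𝓢(V, F) →L[ℂ] 𝓢(W, G)}
    (hA : RapidlyDecreasing s A) (φ : κ → ι) : RapidlyDecreasing (s ∘ φ) fun i => A (φ i) := by
  intro N k n
  obtain ⟨I, C, hC, h⟩ := hA N k n
  exact ⟨I, C, hC, fun i f => h (φ i) f⟩

theorem TemperatelyGrowing.reindex {s : ι → ℝ} {A : ι → 𝓢(V, F) →L[ℂ] 𝓢(W, G)}
    (hA : TemperatelyGrowing s A) (φ : κ → ι) : TemperatelyGrowing (s ∘ φ) fun i => A (φ i) := by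
  intro k n
  obtain ⟨N, I, C, hC, h⟩ := hA k n
  exact ⟨N, I, C, hC, fun i f => h (φ i) f⟩

theorem TemperatelyGrowing.mono {s t : ι → ℝ} {A : ι → 𝓢(V, F) →L[ℂ] 𝓢(W, G)}
    (hA : TemperatelyGrowing s A) (hs : ∀ i, 0 ≤ s i) {c : ℝ} (hc : 0 ≤ c)
    (hst : ∀ i, s i ≤ c * t i) :
    TemperatelyGrowing t A := by
  intro k n
  obtain ⟨N, I, C, hC, h⟩ := hA k n
  refine ⟨N, I, C * c ^ N, by positivity, fun i f => (h i f).trans ?_⟩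
  refine mul_le_mul_of_nonneg_right ?_ (apply_nonneg _ _)
  rw [mul_assoc, ← mul_pow]
  exact mul_le_mul_of_nonneg_left (pow_le_pow_left₀ (hs i) (hst i) N) hC

theorem rapidlyDecreasing_of_bound {s : ι → ℝ} (hs : ∀ i, 0 < s i)
    {A : ι → 𝓢(V, F) →L[ℂ] 𝓢(W, G)}
    (h : ∀ N k n : ℕ, ∃ (I : Finset (ℕ × ℕ)) (C : ℝ), 0 ≤ C ∧ ∀ i f w,
      s i ^ N * (‖w‖ ^ k * ‖iteratedFDeriv ℝ n (A i f) w‖) ≤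
        C * I.sup (schwartzSeminormFamily ℂ V F) f) :
    RapidlyDecreasing s A := by
  intro N k n
  obtain ⟨I, C, hC, h⟩ := h N k n
  refine ⟨I, C, hC, fun i f => ?_⟩
  rw [← le_div_iff₀' (pow_pos (hs i) N)]
  refine SchwartzMap.seminorm_le_bound ℂ k n _
    (div_nonneg (mul_nonneg hC (apply_nonneg _ _)) (pow_pos (hs i) N).le) fun w => ?_
  rw [le_div_iff₀' (pow_pos (hs i) N)]
  exact h i f w

/-! ### Summation -/

/-- Summable seminorms dominate all derivatives uniformly, so the pointwise sum may be
differentiated term by term. -/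
theorem exists_hasSum_apply (g : ι → 𝓢(V, F)) [CompleteSpace F]
    (h : ∀ k n, Summable fun i => SchwartzMap.seminorm ℂ k n (g i)) :
    ∃ S : 𝓢(V, F), (∀ x, HasSum (fun i => g i x) (S x)) ∧
      ∀ k n, SchwartzMap.seminorm ℂ k n S ≤ ∑' i, SchwartzMap.seminorm ℂ k n (g i) := by
  have hle : ∀ k n i x, ‖x‖ ^ k * ‖iteratedFDeriv ℝ n (g i) x‖ ≤
      SchwartzMap.seminorm ℂ k n (g i) := fun k n i x => SchwartzMap.le_seminorm ℂ k n (g i) x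
  have h0 : ∀ (n : ℕ) i x, ((n : ℕ∞) ≤ ⊤) → ‖iteratedFDeriv ℝ n (g i) x‖ ≤
      SchwartzMap.seminorm ℂ 0 n (g i) := fun n i x _ => by simpa using hle 0 n i x
  have hcd : ∀ i, ContDiff ℝ ((⊤ : ℕ∞) : WithTop ℕ∞) (g i) := fun i => (g i).smooth ⊤
  have key : ∀ n x, iteratedFDeriv ℝ n (fun y => ∑' i, g i y) x =
      ∑' i, iteratedFDeriv ℝ n (g i) x := fun n x =>
    iteratedFDeriv_tsum_apply hcd (fun n _ => h 0 n) h0 le_top x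
  have hb : ∀ k n x, ‖x‖ ^ k * ‖iteratedFDeriv ℝ n (fun y => ∑' i, g i y) x‖ ≤
      ∑' i, SchwartzMap.seminorm ℂ k n (g i) := by
    intro k n x
    rw [key]
    have hn : Summable fun i => ‖iteratedFDeriv ℝ n (g i) x‖ :=
      Summable.of_nonneg_of_le (fun i => norm_nonneg _) (fun i => h0 n i x le_top) (h 0 n)
    calc ‖x‖ ^ k * ‖∑' i, iteratedFDeriv ℝ n (g i) x‖
        ≤ ‖x‖ ^ k * ∑' i, ‖iteratedFDeriv ℝ n (g i) x‖ :=
          mul_le_mul_of_nonneg_left (norm_tsum_le_tsum_norm hn) (by positivity)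
      _ = ∑' i, ‖x‖ ^ k * ‖iteratedFDeriv ℝ n (g i) x‖ := tsum_mul_left.symm
      _ ≤ _ := (hn.mul_left _).tsum_le_tsum (fun i => hle k n i x) (h k n)
  refine ⟨⟨fun y => ∑' i, g i y, contDiff_tsum hcd (fun n _ => h 0 n) h0,
    fun k n => ⟨_, hb k n⟩⟩, fun x => ?_, fun k n => ?_⟩
  · refine Summable.hasSum (Summable.of_norm_bounded (h 0 0) fun i => ?_)
    exact SchwartzMap.norm_le_seminorm ℂ (g i) x
  · exact SchwartzMap.seminorm_le_bound ℂ k n _ (tsum_nonneg fun i => apply_nonneg _ _) (hb k n)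

/-- The error of a partial sum is itself a pointwise sum, over the complementary indices. The
pointwise version bounds its seminorms by tails of convergent series, so completeness of the
Schwartz space is not needed. -/
theorem exists_hasSum (g : ι → 𝓢(V, F)) [CompleteSpace F]
    (h : ∀ k n, Summable fun i => SchwartzMap.seminorm ℂ k n (g i)) :
    ∃ S : 𝓢(V, F), HasSum g S ∧
      ∀ k n, SchwartzMap.seminorm ℂ k n S ≤ ∑' i, SchwartzMap.seminorm ℂ k n (g i) := by
  classical
  obtain ⟨S, hS, hb⟩ := exists_hasSum_apply g h
  refine ⟨S, ?_, hb⟩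
  have htail : ∀ (t : Finset ι) k n, SchwartzMap.seminorm ℂ k n (∑ i ∈ t, g i - S) ≤
      ∑' i : {i // i ∉ t}, SchwartzMap.seminorm ℂ k n (g i) := by
    intro t k n
    obtain ⟨T, hT, hTb⟩ := exists_hasSum_apply (fun i : {i // i ∉ t} => g i)
      fun k n => (h k n).subtype _
    have : ∑ i ∈ t, g i - S = -T := by
      ext x
      have h1 := (hT x).tsum_eq
      have h2 := (hS x).summable.sum_add_tsum_subtype_compl t
      rw [h1, (hS x).tsum_eq] at h2
      simp [← h2]
    rw [this, map_neg_eq_map]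
    exact hTb k n
  rw [HasSum, (schwartz_withSeminorms ℂ V F).tendsto_nhds]
  rintro ⟨k, n⟩ ε hε
  have := (tendsto_order.1 (tendsto_tsum_compl_atTop_zero
    fun i => SchwartzMap.seminorm ℂ k n (g i))).2 ε hε
  filter_upwards [this] with t ht
  exact (htail t k n).trans_lt ht

theorem RapidlyDecreasing.exists_summable_bound {s : ι → ℝ} (hs : IsSummableWeight s)
    {A : ι → 𝓢(V, F) →L[ℂ] 𝓢(W, G)} (hA : RapidlyDecreasing s A) (k n : ℕ) :
    ∃ (I : Finset (ℕ × ℕ)) (b : ι → ℝ), Summable b ∧ (∀ i, 0 ≤ b i) ∧ ∀ i f,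
      SchwartzMap.seminorm ℂ k n (A i f) ≤ b i * I.sup (schwartzSeminormFamily ℂ V F) f := by
  obtain ⟨N, hN⟩ := hs.summable
  obtain ⟨I, C, hC, h⟩ := hA N k n
  have hpos : ∀ i, 0 < s i ^ N := fun i => pow_pos (zero_lt_one.trans_le (hs.one_le i)) N
  refine ⟨I, fun i => C * (s i ^ N)⁻¹, hN.mul_left C,
    fun i => mul_nonneg hC (inv_nonneg.2 (hpos i).le), fun i f => ?_⟩
  rw [mul_right_comm, ← div_eq_mul_inv, le_div_iff₀' (hpos i)]
  exact h i f

theorem RapidlyDecreasing.summable_seminorm {s : ι → ℝ} (hs : IsSummableWeight s)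
    {A : ι → 𝓢(V, F) →L[ℂ] 𝓢(W, G)} (hA : RapidlyDecreasing s A) (f : 𝓢(V, F)) (k n : ℕ) :
    Summable fun i => SchwartzMap.seminorm ℂ k n (A i f) := by
  obtain ⟨I, b, hb, -, h⟩ := hA.exists_summable_bound hs k n
  exact Summable.of_nonneg_of_le (fun i => apply_nonneg _ _) (fun i => h i f) (hb.mul_right _)

/-- A rapidly decreasing family of operators can be summed. -/
theorem RapidlyDecreasing.exists_sum [CompleteSpace G] {s : ι → ℝ} (hs : IsSummableWeight s)
    {A : ι → 𝓢(V, F) →L[ℂ] 𝓢(W, G)} (hA : RapidlyDecreasing s A) :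
    ∃ S : 𝓢(V, F) →L[ℂ] 𝓢(W, G), ∀ f, HasSum (fun i => A i f) (S f) := by
  choose S hS hb using fun f => exists_hasSum (fun i => A i f) (hA.summable_seminorm hs f)
  let L : 𝓢(V, F) →ₗ[ℂ] 𝓢(W, G) :=
    { toFun := S
      map_add' := fun f g => (hS (f + g)).unique (by simpa using (hS f).add (hS g))
      map_smul' := fun c f => (hS (c • f)).unique (by simpa using (hS f).const_smul c) }
  refine ⟨⟨L, ?_⟩, hS⟩
  change Continuous L
  refine WithSeminorms.continuous_of_isBounded (schwartz_withSeminorms ℂ V F)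
    (schwartz_withSeminorms ℂ W G) _ fun p => ?_
  obtain ⟨I, b, hbs, hb0, h⟩ := hA.exists_summable_bound hs p.1 p.2
  refine ⟨I, ⟨∑' i, b i, tsum_nonneg hb0⟩, fun f => (hb f p.1 p.2).trans ?_⟩
  calc ∑' i, SchwartzMap.seminorm ℂ p.1 p.2 (A i f)
      ≤ ∑' i, b i * I.sup (schwartzSeminormFamily ℂ V F) f :=
        (hA.summable_seminorm hs f p.1 p.2).tsum_le_tsum (fun i => h i f) (hbs.mul_right _)
    _ = (∑' i, b i) * I.sup (schwartzSeminormFamily ℂ V F) f := tsum_mul_right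

theorem hasSum_apply {g : ι → 𝓢(V, F)} {S : 𝓢(V, F)} (h : HasSum g S) (x : V) :
    HasSum (fun i => g i x) (S x) := by
  have hc : Continuous fun f : 𝓢(V, F) => f x :=
    (continuous_eval_const (F := BoundedContinuousFunction V F) x).comp
      (SchwartzMap.toBoundedContinuousFunctionCLM ℂ V F).continuous
  let ev : 𝓢(V, F) →+ F := ⟨⟨fun f => f x, rfl⟩, fun _ _ => rfl⟩
  exact h.map ev hc

end Families

end

/-! ### Multiplication, translation, modulation and restriction as families of operators -/

section

section ConcreteFamilies

variable {ι κ V W X F G H : Type*}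
  [NormedAddCommGroup V] [NormedSpace ℝ V] [NormedAddCommGroup W] [NormedSpace ℝ W]
  [NormedAddCommGroup X] [NormedSpace ℝ X]
  [NormedAddCommGroup F] [NormedSpace ℝ F] [NormedSpace ℂ F] [SMulCommClass ℝ ℂ F]

omit [NormedSpace ℂ F] [SMulCommClass ℝ ℂ F] in
theorem norm_iteratedFDeriv_comp_affine_le (f : V → F) (hf : ContDiff ℝ ∞ f) (L : W →L[ℝ] V)
    (a : V) (n : ℕ) (w : W) :
    ‖iteratedFDeriv ℝ n (fun w => f (L w + a)) w‖ ≤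
      ‖L‖ ^ n * ‖iteratedFDeriv ℝ n f (L w + a)‖ := by
  have h1 : (fun w => f (L w + a)) = (fun v => f (v + a)) ∘ L := rfl
  have h2 : ContDiff ℝ ∞ fun v => f (v + a) := hf.comp (contDiff_id.add contDiff_const)
  rw [h1, ContinuousLinearMap.iteratedFDeriv_comp_right L h2 w (i := n) (by exact_mod_cast le_top),
    iteratedFDeriv_comp_add_right]
  refine (ContinuousMultilinearMap.norm_compContinuousLinearMap_le _ _).trans (le_of_eq ?_)
  simp [mul_comm]

theorem one_add_norm_pow_mul_le (f : 𝓢(V, F)) {k n K M : ℕ} (hk : k ≤ K) (hn : n ≤ M) (x : V) :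
    (1 + ‖x‖) ^ k * ‖iteratedFDeriv ℝ n f x‖ ≤
      2 ^ K * (Finset.Iic (K, M)).sup (schwartzSeminormFamily ℂ V F) f :=
  SchwartzMap.one_add_le_sup_seminorm_apply (𝕜 := ℂ) (m := (K, M)) hk hn f x

/-- A large `v` forces `w` or `L w - v` to be large; `θ` decays in the first case and `f` in the
second. -/
theorem mulComp_bound (θ : 𝓢(W, ℂ)) (L : W →L[ℝ] V) (N k n : ℕ) :
    ∃ (I : Finset (ℕ × ℕ)) (C : ℝ), 0 ≤ C ∧ ∀ (v : V) (f : 𝓢(V, ℂ)) (w : W),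
      (1 + ‖v‖) ^ N * (‖w‖ ^ k * ‖iteratedFDeriv ℝ n (fun w => θ w * f (L w - v)) w‖) ≤
        C * I.sup (schwartzSeminormFamily ℂ V ℂ) f := by
  set P := (Finset.Iic (N + k, n)).sup (schwartzSeminormFamily ℂ W ℂ) θ
  -- The factor `2 ^ n` is the sum of the binomial coefficients of the Leibniz rule. The order `N +
  -- k` for `θ` covers `‖w‖ ^ k` and the `(1 + ‖w‖) ^ N` that bounding `(1 + ‖v‖) ^ N` produces.
  refine ⟨Finset.Iic (N, n), 2 ^ n * ((1 + ‖L‖) ^ (N + n) * (2 ^ (N + k) * P) * 2 ^ N),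
    by positivity, fun v f w => ?_⟩
  set Q := (Finset.Iic (N, n)).sup (schwartzSeminormFamily ℂ V ℂ) f
  have hv : (1 + ‖v‖) ^ N ≤ (1 + ‖L w - v‖) ^ N * ((1 + ‖L‖) ^ N * (1 + ‖w‖) ^ N) := by
    rw [← mul_pow, ← mul_pow]
    refine pow_le_pow_left₀ (by positivity) ?_ N
    have h1 : ‖v‖ ≤ ‖L w‖ + ‖L w - v‖ := by
      simpa using norm_sub_le (L w) (L w - v)
    have h2 := L.le_opNorm w
    nlinarith [norm_nonneg (L w - v), norm_nonneg L, norm_nonneg w,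
      mul_nonneg (norm_nonneg L) (norm_nonneg w),
      mul_nonneg (norm_nonneg (L w - v)) (mul_nonneg (norm_nonneg L) (norm_nonneg w)),
      mul_nonneg (norm_nonneg (L w - v)) (norm_nonneg w),
      mul_nonneg (norm_nonneg (L w - v)) (norm_nonneg L)]
  have hmul := norm_iteratedFDeriv_mul_le (𝕜 := ℝ) (N := ∞) (n := n) (x := w)
    (f := θ) (g := fun w => f (L w - v)) (θ.smooth ⊤)
    ((f.smooth ⊤).comp (L.contDiff.sub contDiff_const)) (by exact_mod_cast le_top)
  have hterm : ∀ i ∈ Finset.range (n + 1),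
      (1 + ‖v‖) ^ N * (‖w‖ ^ k * (n.choose i * ‖iteratedFDeriv ℝ i θ w‖ *
        ‖iteratedFDeriv ℝ (n - i) (fun w => f (L w - v)) w‖)) ≤
      n.choose i * (((1 + ‖L‖) ^ (N + n) * (2 ^ (N + k) * P) * 2 ^ N) * Q) := by
    intro i hi
    have hi' : i ≤ n := Nat.lt_succ_iff.1 (Finset.mem_range.1 hi)
    have hθ := one_add_norm_pow_mul_le θ le_rfl hi' w (k := N + k)
    have hf := one_add_norm_pow_mul_le f le_rfl (Nat.sub_le n i) (L w - v) (k := N)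
    have hc := norm_iteratedFDeriv_comp_affine_le f (f.smooth ⊤) L (-v) (n - i) w
    simp only [← sub_eq_add_neg] at hc
    have hL : ‖L‖ ^ (n - i) ≤ (1 + ‖L‖) ^ n :=
      (pow_le_pow_left₀ (norm_nonneg L) (by linarith [norm_nonneg L]) _).trans
        (pow_le_pow_right₀ (by linarith [norm_nonneg L]) (Nat.sub_le n i))
    have hw : ‖w‖ ^ k ≤ (1 + ‖w‖) ^ k := pow_le_pow_left₀ (norm_nonneg w) (by linarith) k
    calc (1 + ‖v‖) ^ N * (‖w‖ ^ k * (n.choose i * ‖iteratedFDeriv ℝ i θ w‖ *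
          ‖iteratedFDeriv ℝ (n - i) (fun w => f (L w - v)) w‖))
        ≤ ((1 + ‖L w - v‖) ^ N * ((1 + ‖L‖) ^ N * (1 + ‖w‖) ^ N)) * ((1 + ‖w‖) ^ k *
          (n.choose i * ‖iteratedFDeriv ℝ i θ w‖ *
            ((1 + ‖L‖) ^ n * ‖iteratedFDeriv ℝ (n - i) f (L w - v)‖))) := by
          gcongr
          exact hc.trans (mul_le_mul_of_nonneg_right hL (norm_nonneg _))
      _ = n.choose i * ((1 + ‖L‖) ^ (N + n) *
            ((1 + ‖w‖) ^ (N + k) * ‖iteratedFDeriv ℝ i θ w‖) *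
            ((1 + ‖L w - v‖) ^ N * ‖iteratedFDeriv ℝ (n - i) f (L w - v)‖)) := by
          rw [pow_add, pow_add]; ring
      _ ≤ n.choose i * ((1 + ‖L‖) ^ (N + n) * (2 ^ (N + k) * P) * (2 ^ N * Q)) := by
          gcongr
      _ = _ := by ring
  calc (1 + ‖v‖) ^ N * (‖w‖ ^ k * ‖iteratedFDeriv ℝ n (fun w => θ w * f (L w - v)) w‖)
      ≤ (1 + ‖v‖) ^ N * (‖w‖ ^ k * ∑ i ∈ Finset.range (n + 1), n.choose i *
          ‖iteratedFDeriv ℝ i θ w‖ * ‖iteratedFDeriv ℝ (n - i) (fun w => f (L w - v)) w‖) := by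
        gcongr
    _ = ∑ i ∈ Finset.range (n + 1), (1 + ‖v‖) ^ N * (‖w‖ ^ k * (n.choose i *
          ‖iteratedFDeriv ℝ i θ w‖ *
            ‖iteratedFDeriv ℝ (n - i) (fun w => f (L w - v)) w‖)) := by
        rw [Finset.mul_sum, Finset.mul_sum]
    _ ≤ ∑ i ∈ Finset.range (n + 1), (n.choose i : ℝ) *
          (((1 + ‖L‖) ^ (N + n) * (2 ^ (N + k) * P) * 2 ^ N) * Q) := Finset.sum_le_sum hterm
    _ = _ := by
        rw [← Finset.sum_mul, ← Nat.cast_sum, Nat.sum_range_choose]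
        push_cast
        ring

/-- The operator `f ↦ (w ↦ θ(w) f(L w - v))`. -/
def mulComp (θ : 𝓢(W, ℂ)) (L : W →L[ℝ] V) (v : V) : 𝓢(V, ℂ) →L[ℂ] 𝓢(W, ℂ) :=
  SchwartzMap.mkCLM (fun f w => θ w * f (L w - v)) (fun f g w => by simp [mul_add])
    (fun a f w => by simp [mul_left_comm])
    (fun f => (θ.smooth ⊤).mul ((f.smooth ⊤).comp (L.contDiff.sub contDiff_const)))
    (fun n => by
      obtain ⟨I, C, hC, h⟩ := mulComp_bound θ L 0 n.1 n.2
      exact ⟨I, C, hC, fun f w => by simpa using h v f w⟩)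

@[simp]
theorem mulComp_apply (θ : 𝓢(W, ℂ)) (L : W →L[ℝ] V) (v : V) (f : 𝓢(V, ℂ)) (w : W) :
    mulComp θ L v f w = θ w * f (L w - v) := rfl

theorem rapidlyDecreasing_mulComp (θ : 𝓢(W, ℂ)) (L : W →L[ℝ] V) :
    RapidlyDecreasing (fun v : V => 1 + ‖v‖) (mulComp θ L) :=
  rapidlyDecreasing_of_bound (fun v => by positivity) fun N k n => mulComp_bound θ L N k n

theorem temperatelyGrowing_compSubConst :
    TemperatelyGrowing (fun v : V => 1 + ‖v‖)
      fun v => (SchwartzMap.compSubConstCLM ℂ v : 𝓢(V, F) →L[ℂ] 𝓢(V, F)) := by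
  intro k n
  refine ⟨k, Finset.Iic (k, n), 2 ^ k, by positivity, fun v f => ?_⟩
  refine SchwartzMap.seminorm_le_bound ℂ k n _ (by positivity) fun x => ?_
  have h1 : iteratedFDeriv ℝ n (SchwartzMap.compSubConstCLM ℂ v f) x =
      iteratedFDeriv ℝ n f (x - v) := iteratedFDeriv_comp_sub n v x
  have h2 : ‖x‖ ≤ (1 + ‖v‖) * (1 + ‖x - v‖) := by
    have : ‖x‖ ≤ ‖x - v‖ + ‖v‖ := by simpa using norm_add_le (x - v) v
    nlinarith [norm_nonneg v, norm_nonneg (x - v)]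
  rw [h1]
  calc ‖x‖ ^ k * ‖iteratedFDeriv ℝ n f (x - v)‖
      ≤ ((1 + ‖v‖) * (1 + ‖x - v‖)) ^ k * ‖iteratedFDeriv ℝ n f (x - v)‖ := by gcongr
    _ = (1 + ‖v‖) ^ k * ((1 + ‖x - v‖) ^ k * ‖iteratedFDeriv ℝ n f (x - v)‖) := by
        rw [mul_pow, mul_assoc]
    _ ≤ (1 + ‖v‖) ^ k * (2 ^ k * (Finset.Iic (k, n)).sup (schwartzSeminormFamily ℂ V F) f) := by
        exact mul_le_mul_of_nonneg_left (one_add_norm_pow_mul_le f le_rfl le_rfl _)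
          (by positivity)
    _ = _ := by ring

theorem contDiff_cexp_I : ContDiff ℝ ∞ (fun t : ℝ => Complex.exp (Complex.I * t)) :=
  (contDiff_const.mul Complex.ofRealCLM.contDiff).cexp

theorem norm_iteratedFDeriv_cexp_I (n : ℕ) (t : ℝ) :
    ‖iteratedFDeriv ℝ n (fun t : ℝ => Complex.exp (Complex.I * t)) t‖ = 1 := by
  have key : ∀ n : ℕ, iteratedDeriv n (fun t : ℝ => Complex.exp (Complex.I * t)) =
      fun t : ℝ => Complex.I ^ n * Complex.exp (Complex.I * t) := by
    intro n
    induction n with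
    | zero => simp
    | succ n ih =>
      rw [iteratedDeriv_succ, ih]
      funext t
      have h1 : HasDerivAt (fun t : ℝ => Complex.I * (t : ℂ)) Complex.I t := by
        simpa using (Complex.ofRealCLM.hasDerivAt (x := t)).const_mul Complex.I
      rw [(h1.cexp.const_mul (Complex.I ^ n)).deriv]
      ring
  rw [norm_iteratedFDeriv_eq_norm_iteratedDeriv, key]
  simp [mul_comm Complex.I, Complex.norm_exp_ofReal_mul_I]

theorem hasTemperateGrowth_expLinear (ℓ : V →L[ℝ] ℝ) :
    (fun v : V => Complex.exp (Complex.I * ℓ v)).HasTemperateGrowth :=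
  hasTemperateGrowth_exp.comp ℓ.hasTemperateGrowth

/-- Multiplication by `e^{i ℓ}` for a linear form `ℓ`. -/
def expMul (ℓ : V →L[ℝ] ℝ) : 𝓢(V, ℂ) →L[ℂ] 𝓢(V, ℂ) :=
  SchwartzMap.smulLeftCLM ℂ fun v => Complex.exp (Complex.I * ℓ v)

@[simp]
theorem expMul_apply (ℓ : V →L[ℝ] ℝ) (f : 𝓢(V, ℂ)) (v : V) :
    expMul ℓ f v = Complex.exp (Complex.I * ℓ v) * f v := by
  simp [expMul, SchwartzMap.smulLeftCLM_apply_apply (hasTemperateGrowth_expLinear ℓ)]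

/-- Each derivative that falls on the exponential costs at most a factor `‖ℓ‖`. -/
theorem temperatelyGrowing_expMul :
    TemperatelyGrowing (fun ℓ : V →L[ℝ] ℝ => 1 + ‖ℓ‖) expMul := by
  intro k n
  refine ⟨n, Finset.Iic (k, n), 2 ^ n * 2 ^ k, by positivity, fun ℓ f => ?_⟩
  refine SchwartzMap.seminorm_le_bound ℂ k n _ (by positivity) fun x => ?_
  set Q := (Finset.Iic (k, n)).sup (schwartzSeminormFamily ℂ V ℂ) f
  have hfun : (expMul ℓ f : V → ℂ) = fun v => Complex.exp (Complex.I * ℓ v) * f v :=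
    funext fun v => expMul_apply ℓ f v
  have hcd : ContDiff ℝ ∞ fun v => Complex.exp (Complex.I * ℓ v) :=
    contDiff_cexp_I.comp ℓ.contDiff
  have hmul := norm_iteratedFDeriv_mul_le (𝕜 := ℝ) (N := ∞) (n := n) (x := x) hcd
    (f.smooth ⊤) (by exact_mod_cast le_top)
  have hterm : ∀ i ∈ Finset.range (n + 1),
      ‖x‖ ^ k * (n.choose i * ‖iteratedFDeriv ℝ i (fun v => Complex.exp (Complex.I * ℓ v)) x‖ *
        ‖iteratedFDeriv ℝ (n - i) f x‖) ≤ n.choose i * ((1 + ‖ℓ‖) ^ n * (2 ^ k * Q)) := by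
    intro i hi
    have hi' : i ≤ n := Nat.lt_succ_iff.1 (Finset.mem_range.1 hi)
    have h1 : ‖iteratedFDeriv ℝ i (fun v => Complex.exp (Complex.I * ℓ v)) x‖ ≤
        (1 + ‖ℓ‖) ^ n := by
      have := norm_iteratedFDeriv_comp_affine_le _ contDiff_cexp_I ℓ 0 i x
      simp only [add_zero, norm_iteratedFDeriv_cexp_I, mul_one] at this
      exact this.trans ((pow_le_pow_left₀ (norm_nonneg ℓ) (by linarith [norm_nonneg ℓ]) _).trans
        (pow_le_pow_right₀ (by linarith [norm_nonneg ℓ]) hi'))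
    have h2 : ‖x‖ ^ k * ‖iteratedFDeriv ℝ (n - i) f x‖ ≤ 2 ^ k * Q := by
      refine le_trans ?_ (one_add_norm_pow_mul_le f le_rfl (Nat.sub_le n i) x (k := k))
      gcongr
      linarith
    calc _ = n.choose i * (‖iteratedFDeriv ℝ i (fun v => Complex.exp (Complex.I * ℓ v)) x‖ *
          (‖x‖ ^ k * ‖iteratedFDeriv ℝ (n - i) f x‖)) := by ring
      _ ≤ _ := by gcongr
  rw [hfun]
  calc _ ≤ ‖x‖ ^ k * ∑ i ∈ Finset.range (n + 1), n.choose i *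
          ‖iteratedFDeriv ℝ i (fun v => Complex.exp (Complex.I * ℓ v)) x‖ *
            ‖iteratedFDeriv ℝ (n - i) f x‖ := by gcongr
    _ ≤ ∑ i ∈ Finset.range (n + 1), (n.choose i : ℝ) * ((1 + ‖ℓ‖) ^ n * (2 ^ k * Q)) := by
        rw [Finset.mul_sum]
        exact Finset.sum_le_sum hterm
    _ = _ := by
        rw [← Finset.sum_mul, ← Nat.cast_sum, Nat.sum_range_choose]
        push_cast
        ring

/-! ### Restriction to affine subspaces -/

/-- The condition on `a` trades the weight at `w` for the weight at the image point, with constants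
that do not depend on `a`. Slices of a product satisfy it because the norm is the maximum. -/
theorem compAffine_bound (L : W →L[ℝ] V) (N k n : ℕ) :
    ∃ (I : Finset (ℕ × ℕ)) (C : ℝ), 0 ≤ C ∧ ∀ (a : V), (∀ w, ‖w‖ ≤ ‖L w + a‖) →
      ∀ (f : 𝓢(V, F)) (w : W),
      ‖L w + a‖ ^ N * (‖w‖ ^ k * ‖iteratedFDeriv ℝ n (fun w => f (L w + a)) w‖) ≤
        C * I.sup (schwartzSeminormFamily ℂ V F) f := by
  refine ⟨{(N + k, n)}, ‖L‖ ^ n, by positivity, fun a ha f w => ?_⟩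
  have h1 := norm_iteratedFDeriv_comp_affine_le f (f.smooth ⊤) L a n w
  have h2 := SchwartzMap.le_seminorm ℂ (N + k) n f (L w + a)
  simp only [Finset.sup_singleton, schwartzSeminormFamily_apply]
  calc _ ≤ ‖L w + a‖ ^ N * (‖L w + a‖ ^ k *
        (‖L‖ ^ n * ‖iteratedFDeriv ℝ n f (L w + a)‖)) := by
        gcongr
        exact ha w
    _ = ‖L‖ ^ n * (‖L w + a‖ ^ (N + k) * ‖iteratedFDeriv ℝ n f (L w + a)‖) := by
        rw [pow_add]; ring
    _ ≤ _ := by gcongr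

/-- Restriction of a Schwartz function to the affine subspace `L + a`. -/
def compAffine (L : W →L[ℝ] V) (a : V) (h : ∀ w, ‖w‖ ≤ ‖L w + a‖) : 𝓢(V, F) →L[ℂ] 𝓢(W, F) :=
  SchwartzMap.mkCLM (fun f w => f (L w + a)) (fun f g w => by simp) (fun c f w => by simp)
    (fun f => (f.smooth ⊤).comp (L.contDiff.add contDiff_const))
    (fun n => by
      obtain ⟨I, C, hC, hb⟩ := compAffine_bound (F := F) L 0 n.1 n.2
      exact ⟨I, C, hC, fun f w => by simpa using hb a h f w⟩)

@[simp]
theorem compAffine_apply (L : W →L[ℝ] V) (a : V) (h : ∀ w, ‖w‖ ≤ ‖L w + a‖) (f : 𝓢(V, F))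
    (w : W) : compAffine L a h f w = f (L w + a) := rfl

/-- The restriction `ξ ↦ Φ(x, ξ)`. -/
def slice (x : V) : 𝓢(V × W, F) →L[ℂ] 𝓢(W, F) :=
  compAffine (ContinuousLinearMap.inr ℝ V W) (x, 0) fun w => by
    simp [Prod.norm_def]

@[simp]
theorem slice_apply (x : V) (Φ : 𝓢(V × W, F)) (ξ : W) : slice x Φ ξ = Φ (x, ξ) := by
  simp [slice]

theorem rapidlyDecreasing_slice :
    RapidlyDecreasing (fun x : V => 1 + ‖x‖) (slice : V → 𝓢(V × W, F) →L[ℂ] 𝓢(W, F)) := by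
  refine rapidlyDecreasing_of_bound (fun x => by positivity) fun N k n => ?_
  -- The powers `0` and `N` are both needed, since `(1 + ‖x‖) ^ N` is split into a constant and an
  -- `N`-th power.
  obtain ⟨I, C, hC, h⟩ := compAffine_bound (F := F) (ContinuousLinearMap.inr ℝ V W) 0 k n
  obtain ⟨J, D, hD, h'⟩ := compAffine_bound (F := F) (ContinuousLinearMap.inr ℝ V W) N k n
  classical
  refine ⟨I ∪ J, 2 ^ N * (C + D), by positivity, fun x Φ ξ => ?_⟩
  have hx : ∀ w : W, ‖w‖ ≤ ‖ContinuousLinearMap.inr ℝ V W w + (x, 0)‖ := fun w => by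
    simp [Prod.norm_def]
  have h1 := h (x, 0) hx Φ ξ
  have h2 := h' (x, 0) hx Φ ξ
  have h3 : (1 + ‖x‖) ^ N ≤ 2 ^ N * (1 + ‖ContinuousLinearMap.inr ℝ V W ξ + (x, 0)‖ ^ N) := by
    have hxx : ‖x‖ ≤ ‖ContinuousLinearMap.inr ℝ V W ξ + (x, 0)‖ := by simp [Prod.norm_def]
    refine (add_pow_le (by positivity) (norm_nonneg x) N).trans ?_
    rw [one_pow]
    gcongr
    · norm_num
    · exact Nat.sub_le N 1
  have hI := Seminorm.le_def.1 (Finset.sup_mono (f := schwartzSeminormFamily ℂ (V × W) F)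
    (Finset.subset_union_left (s₁ := I) (s₂ := J))) Φ
  have hJ := Seminorm.le_def.1 (Finset.sup_mono (f := schwartzSeminormFamily ℂ (V × W) F)
    (Finset.subset_union_right (s₁ := I) (s₂ := J))) Φ
  change (1 + ‖x‖) ^ N * (‖ξ‖ ^ k * ‖iteratedFDeriv ℝ n
    (fun w => Φ (ContinuousLinearMap.inr ℝ V W w + (x, 0))) ξ‖) ≤ _
  set T := ‖ξ‖ ^ k * ‖iteratedFDeriv ℝ n
    (fun w => Φ (ContinuousLinearMap.inr ℝ V W w + (x, 0))) ξ‖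
  have hT : 0 ≤ T := by positivity
  rw [pow_zero, one_mul] at h1
  calc (1 + ‖x‖) ^ N * T
      ≤ (2 ^ N * (1 + ‖ContinuousLinearMap.inr ℝ V W ξ + (x, 0)‖ ^ N)) * T := by gcongr
    _ = 2 ^ N * (T + ‖ContinuousLinearMap.inr ℝ V W ξ + (x, 0)‖ ^ N * T) := by ring
    _ ≤ 2 ^ N * (C * (I ∪ J).sup (schwartzSeminormFamily ℂ (V × W) F) Φ +
          D * (I ∪ J).sup (schwartzSeminormFamily ℂ (V × W) F) Φ) := by
        exact mul_le_mul_of_nonneg_left (add_le_add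
          (h1.trans (mul_le_mul_of_nonneg_left hI hC))
          (h2.trans (mul_le_mul_of_nonneg_left hJ hD))) (by positivity)
    _ = _ := by ring

end ConcreteFamilies

end

section

variable {d : ℕ}

/-! ### The partial Fourier transform -/

section PartialFourier

variable {V F : Type} [NormedAddCommGroup V] [NormedSpace ℝ V]
  [NormedAddCommGroup F] [NormedSpace ℂ F]

theorem norm_character (k ξ : Space d) : ‖character k ξ‖ = 1 := by
  rw [character, mul_comm, Complex.norm_exp_ofReal_mul_I]

theorem continuous_character (k : Space d) : Continuous (character k) := by
  unfold character
  fun_prop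

/-- Fixes the normalization: the kernel of `FourierTransform.fourier` is `e^{-2πi⟪ξ, w⟫}`, hence `w
= -η / 2π`. -/
theorem integral_character_smul_slice (η : Space d) (g : 𝓢(Space d, F)) :
    ∫ ξ, character η ξ • g ξ = FourierTransform.fourier g (-(2 * Real.pi)⁻¹ • η) := by
  rw [SchwartzMap.fourier_coe, Real.fourier_eq]
  congr 1
  ext ξ
  rw [Circle.smul_def, Real.fourierChar_apply, inner_smul_right, character, real_inner_comm]
  congr 2
  have := Real.pi_ne_zero
  push_cast
  field_simp

/-- Decay in `η` comes from the Fourier transform of each slice being Schwartz, decay in `x` from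
the slices being rapidly decreasing in `x`. -/
theorem partialFourier_bound_zero (V F : Type) [NormedAddCommGroup V] [NormedSpace ℝ V]
    [NormedAddCommGroup F] [NormedSpace ℂ F] (N k : ℕ) :
    ∃ (I : Finset (ℕ × ℕ)) (C : ℝ), 0 ≤ C ∧ ∀ (η : Space d) (Φ : 𝓢(V × Space d, F)) (x : V),
      (1 + ‖η‖) ^ N * (‖x‖ ^ k * ‖∫ ξ, character η ξ • Φ (x, ξ)‖) ≤
        C * I.sup (schwartzSeminormFamily ℂ (V × Space d) F) Φ := by
  obtain ⟨J, D, hD, h⟩ := exists_sup_bound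
    (SchwartzMap.fourierTransformCLM ℂ : 𝓢(Space d, F) →L[ℂ] 𝓢(Space d, F)) (Finset.Iic (N, 0))
  obtain ⟨I, C, hC, h'⟩ := (rapidlyDecreasing_slice (V := V) (W := Space d) (F := F)).sup
    (fun x => by positivity) k J
  refine ⟨I, (2 * Real.pi) ^ N * (2 ^ N * D) * C, by positivity, fun η Φ x => ?_⟩
  have h1 := integral_character_smul_slice η (slice x Φ)
  simp only [slice_apply] at h1
  rw [h1]
  set g := slice x Φ
  set w := -(2 * Real.pi)⁻¹ • η
  have hpi : 1 ≤ 2 * Real.pi := by linarith [Real.two_le_pi]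
  have hη : 1 + ‖η‖ ≤ 2 * Real.pi * (1 + ‖w‖) := by
    have : η = -(2 * Real.pi) • w := by
      simp only [w, smul_smul]
      rw [neg_mul_neg, mul_inv_cancel₀ (by positivity), one_smul]
    have h2 : ‖η‖ = 2 * Real.pi * ‖w‖ := by
      rw [this, norm_smul, norm_neg, Real.norm_of_nonneg (by positivity)]
    rw [h2]
    linarith
  have h3 : (1 + ‖w‖) ^ N * ‖FourierTransform.fourier g w‖ ≤
      2 ^ N * (D * J.sup (schwartzSeminormFamily ℂ (Space d) F) g) := by
    have := one_add_norm_pow_mul_le (FourierTransform.fourier g) (le_refl N) (le_refl 0) w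
    rw [norm_iteratedFDeriv_zero] at this
    exact this.trans (mul_le_mul_of_nonneg_left (h g) (by positivity))
  have hx : ‖x‖ ^ k ≤ (1 + ‖x‖) ^ k := pow_le_pow_left₀ (norm_nonneg x) (by linarith) k
  calc (1 + ‖η‖) ^ N * (‖x‖ ^ k * ‖FourierTransform.fourier g w‖)
      ≤ (2 * Real.pi * (1 + ‖w‖)) ^ N * ((1 + ‖x‖) ^ k * ‖FourierTransform.fourier g w‖) := by
        gcongr
    _ = (2 * Real.pi) ^ N * ((1 + ‖x‖) ^ k *
          ((1 + ‖w‖) ^ N * ‖FourierTransform.fourier g w‖)) := by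
        rw [mul_pow]; ring
    _ ≤ (2 * Real.pi) ^ N * ((1 + ‖x‖) ^ k *
          (2 ^ N * (D * J.sup (schwartzSeminormFamily ℂ (Space d) F) g))) := by gcongr
    _ = (2 * Real.pi) ^ N * (2 ^ N * D) *
          ((1 + ‖x‖) ^ k * J.sup (schwartzSeminormFamily ℂ (Space d) F) g) := by ring
    _ ≤ (2 * Real.pi) ^ N * (2 ^ N * D) *
          (C * I.sup (schwartzSeminormFamily ℂ (V × Space d) F) Φ) := by
        exact mul_le_mul_of_nonneg_left (h' x Φ) (by positivity)
    _ = _ := by ring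

/-- Restriction of linear maps to the first factor. -/
def precompInl (V W F : Type) [NormedAddCommGroup V] [NormedSpace ℝ V] [NormedAddCommGroup W]
    [NormedSpace ℝ W] [NormedAddCommGroup F] [NormedSpace ℂ F] :
    (V × W →L[ℝ] F) →L[ℂ] (V →L[ℝ] F) :=
  LinearMap.mkContinuous
    { toFun := fun T => T.comp (ContinuousLinearMap.inl ℝ V W)
      map_add' := fun _ _ => rfl
      map_smul' := fun _ _ => rfl } ‖ContinuousLinearMap.inl ℝ V W‖
    fun T => by
      rw [mul_comm]
      exact T.opNorm_comp_le _

/-- The partial derivative with respect to the first factor. -/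
def fderivFst (V W F : Type) [NormedAddCommGroup V] [NormedSpace ℝ V] [NormedAddCommGroup W]
    [NormedSpace ℝ W] [NormedAddCommGroup F] [NormedSpace ℂ F] :
    𝓢(V × W, F) →L[ℂ] 𝓢(V × W, V →L[ℝ] F) :=
  (SchwartzMap.postcompCLM (precompInl V W F)).comp (SchwartzMap.fderivCLM ℂ (V × W) F)

theorem hasFDerivAt_partialFourier (η : Space d) (Φ : 𝓢(V × Space d, F)) (x : V) :
    HasFDerivAt (fun x => ∫ ξ, character η ξ • Φ (x, ξ))
      (∫ ξ, character η ξ • fderivFst V (Space d) F Φ (x, ξ)) x := by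
  set n := (volume : Measure (Space d)).integrablePower
  set Ψ := fderivFst V (Space d) F Φ
  set C := 2 ^ n * (Finset.Iic (n, 0)).sup
    (schwartzSeminormFamily ℂ (V × Space d) (V →L[ℝ] F)) Ψ
  have hint : ∀ (G : Type) [NormedAddCommGroup G] [NormedSpace ℂ G] (g : 𝓢(Space d, G)),
      Integrable fun ξ => character η ξ • g ξ := fun G _ _ g =>
    g.integrable.mono ((continuous_character η).smul g.continuous).aestronglyMeasurable
      (Filter.Eventually.of_forall fun ξ => by rw [norm_smul, norm_character, one_mul])
  -- Differentiation under the integral; the Schwartz decay of the partial derivative in `ξ` gives a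
  -- dominating function that does not depend on `x`.
  refine hasFDerivAt_integral_of_dominated_of_fderiv_le (s := Set.univ) (𝕜 := ℝ)
    (bound := fun ξ => C * (1 + ‖ξ‖) ^ (-(n : ℝ)))
    (F' := fun x ξ => character η ξ • Ψ (x, ξ))
    Filter.univ_mem (Filter.Eventually.of_forall fun x => ?_) ?_ ?_
    (Filter.Eventually.of_forall fun ξ x _ => ?_)
    ((Measure.integrable_pow_neg_integrablePower _).const_mul C)
    (Filter.Eventually.of_forall fun ξ x _ => ?_)
  · simpa using (hint F (slice x Φ)).aestronglyMeasurable
  · simpa using hint F (slice x Φ)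
  · simpa using (hint (V →L[ℝ] F) (slice x Ψ)).aestronglyMeasurable
  · rw [norm_smul, norm_character, one_mul, Real.rpow_neg (by positivity), Real.rpow_natCast,
      ← div_eq_mul_inv, le_div_iff₀' (by positivity)]
    have := one_add_norm_pow_mul_le Ψ (le_refl n) (le_refl 0) (x, ξ)
    rw [norm_iteratedFDeriv_zero] at this
    refine le_trans ?_ this
    gcongr
    exact norm_snd_le (x, ξ)
  · have h1 : HasFDerivAt (fun x => Φ (x, ξ)) (Ψ (x, ξ)) x :=
      (Φ.hasFDerivAt (x, ξ)).comp x (hasFDerivAt_prodMk_left x ξ)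
    exact h1.const_smul _

/-- The target `F` is quantified after `n` because the derivative is a partial Fourier transform
with values in `V →L[ℝ] F`, to which the induction hypothesis is applied. The next bound is
organized in the same way. -/
theorem contDiff_partialFourier (n : ℕ) : ∀ (F : Type) [NormedAddCommGroup F] [NormedSpace ℂ F]
    (η : Space d) (Φ : 𝓢(V × Space d, F)),
    ContDiff ℝ n fun x => ∫ ξ, character η ξ • Φ (x, ξ) := by
  induction n with
  | zero =>
    intro F _ _ η Φ
    exact contDiff_zero.2 (continuous_iff_continuousAt.2 fun x =>
      (hasFDerivAt_partialFourier η Φ x).continuousAt)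
  | succ n ih =>
    intro F _ _ η Φ
    refine contDiff_succ_iff_hasFDerivAt.2 ⟨_, ih (V →L[ℝ] F) η (fderivFst V (Space d) F Φ),
      fun x => hasFDerivAt_partialFourier η Φ x⟩

theorem partialFourier_bound (n : ℕ) : ∀ (F : Type) [NormedAddCommGroup F] [NormedSpace ℂ F]
    (N k : ℕ), ∃ (I : Finset (ℕ × ℕ)) (C : ℝ), 0 ≤ C ∧
      ∀ (η : Space d) (Φ : 𝓢(V × Space d, F)) (x : V), (1 + ‖η‖) ^ N *
        (‖x‖ ^ k * ‖iteratedFDeriv ℝ n (fun x => ∫ ξ, character η ξ • Φ (x, ξ)) x‖) ≤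
        C * I.sup (schwartzSeminormFamily ℂ (V × Space d) F) Φ := by
  induction n with
  | zero =>
    intro F _ _ N k
    simpa only [norm_iteratedFDeriv_zero] using partialFourier_bound_zero V F N k
  | succ n ih =>
    intro F _ _ N k
    obtain ⟨J, D, hD, h⟩ := ih (V →L[ℝ] F) N k
    obtain ⟨I, C, hC, h'⟩ := exists_sup_bound (fderivFst V (Space d) F) J
    refine ⟨I, D * C, by positivity, fun η Φ x => ?_⟩
    have hf : fderiv ℝ (fun x => ∫ ξ, character η ξ • Φ (x, ξ)) =
        fun x => ∫ ξ, character η ξ • fderivFst V (Space d) F Φ (x, ξ) :=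
      funext fun x => (hasFDerivAt_partialFourier η Φ x).fderiv
    rw [← norm_iteratedFDeriv_fderiv, hf, mul_assoc D]
    exact (h η _ x).trans (mul_le_mul_of_nonneg_left (h' Φ) hD)

/-- The operator `Φ ↦ (x ↦ ∫ e^{i⟪η, ξ⟫} Φ(x, ξ) dξ)`. -/
def partialFourier (η : Space d) : 𝓢(V × Space d, ℂ) →L[ℂ] 𝓢(V, ℂ) :=
  SchwartzMap.mkCLM (fun Φ x => ∫ ξ, character η ξ • Φ (x, ξ))
    (fun Φ Ψ x => by
      have hint : ∀ g : 𝓢(Space d, ℂ), Integrable fun ξ => character η ξ • g ξ := fun g =>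
        g.integrable.mono ((continuous_character η).smul g.continuous).aestronglyMeasurable
          (Filter.Eventually.of_forall fun ξ => by rw [norm_smul, norm_character, one_mul])
      have := integral_add (hint (slice x Φ)) (hint (slice x Ψ))
      simpa [mul_add] using this)
    (fun c Φ x => by
      have := integral_const_mul (μ := volume) c fun ξ => character η ξ * Φ (x, ξ)
      simpa [mul_left_comm] using this)
    (fun Φ => contDiff_infty.2 fun n => contDiff_partialFourier n ℂ η Φ)
    (fun n => by
      obtain ⟨I, C, hC, h⟩ := partialFourier_bound (V := V) (d := d) n.2 ℂ 0 n.1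
      exact ⟨I, C, hC, fun Φ x => by simpa using h η Φ x⟩)

theorem partialFourier_apply (η : Space d) (Φ : 𝓢(V × Space d, ℂ)) (x : V) :
    partialFourier η Φ x = ∫ ξ, character η ξ * Φ (x, ξ) := rfl

theorem rapidlyDecreasing_partialFourier :
    RapidlyDecreasing (fun η : Space d => 1 + ‖η‖)
      (partialFourier : Space d → 𝓢(V × Space d, ℂ) →L[ℂ] 𝓢(V, ℂ)) :=
  rapidlyDecreasing_of_bound (fun η => by positivity) fun N k n =>
    partialFourier_bound n ℂ N k

end PartialFourier

end

section

variable {d : ℕ}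

/-! ### Locally smooth series -/

section LocalSeries

variable {ι W : Type*} [NormedAddCommGroup W] [NormedSpace ℝ W] [FiniteDimensional ℝ W]

theorem exists_schwartz_eventually_eq_one (w : W) :
    ∃ θ : 𝓢(W, ℂ), HasCompactSupport θ ∧ ∀ᶠ v in nhds w, θ v = 1 := by
  let b : ContDiffBump w := ⟨1, 2, one_pos, one_lt_two⟩
  have hs : HasCompactSupport fun v => (b v : ℂ) :=
    b.hasCompactSupport.comp_left (g := fun r : ℝ => (r : ℂ)) Complex.ofReal_zero
  refine ⟨hs.toSchwartzMap (Complex.ofRealCLM.contDiff.comp b.contDiff), hs, ?_⟩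
  filter_upwards [b.eventuallyEq_one] with v hv
  change ((b v : ℝ) : ℂ) = 1
  rw [hv]
  simp

/-- A series of functions on `W` that converges to a Schwartz function when multiplied by any
Schwartz function. -/
def LocallySchwartzSeries (f : ι → W → ℂ) : Prop :=
  ∀ θ : 𝓢(W, ℂ), ∃ G : 𝓢(W, ℂ), ∀ w, HasSum (fun i => θ w * f i w) (G w)

theorem LocallySchwartzSeries.summable {f : ι → W → ℂ} (hf : LocallySchwartzSeries f) (w : W) :
    Summable fun i => f i w := by
  obtain ⟨θ, -, hθ⟩ := exists_schwartz_eventually_eq_one w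
  obtain ⟨G, hG⟩ := hf θ
  simpa [hθ.self_of_nhds] using (hG w).summable

theorem LocallySchwartzSeries.exists_eq {f : ι → W → ℂ} (hf : LocallySchwartzSeries f)
    (θ : 𝓢(W, ℂ)) : ∃ G : 𝓢(W, ℂ), ∀ w, G w = θ w * ∑' i, f i w := by
  obtain ⟨G, hG⟩ := hf θ
  exact ⟨G, fun w => (hG w).unique ((hf.summable w).hasSum.mul_left _)⟩

theorem LocallySchwartzSeries.contDiff {f : ι → W → ℂ} (hf : LocallySchwartzSeries f) :
    ContDiff ℝ ∞ fun w => ∑' i, f i w := by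
  refine contDiff_iff_contDiffAt.2 fun w => ?_
  obtain ⟨θ, -, hθ⟩ := exists_schwartz_eventually_eq_one w
  obtain ⟨G, hG⟩ := hf.exists_eq θ
  refine ((G.smooth ⊤).contDiffAt (x := w)).congr_of_eventuallyEq ?_
  filter_upwards [hθ] with v hv
  rw [hG, hv, one_mul]

end LocalSeries

/-! ### Lattices and characters -/

theorem linearIndependent_dualBasis (E : Module.Basis (Fin d) ℝ (Space d)) :
    LinearIndependent ℝ (dualBasis E) := by
  rw [Fintype.linearIndependent_iff]
  intro g hg j
  have h := congrArg (fun v => inner ℝ (E j) v) hg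
  simp only [inner_sum, inner_smul_right, inner_dualBasis, inner_zero_right] at h
  simpa [Real.pi_ne_zero] using h

/-- The dual basis, as a basis. -/
def dual (E : Module.Basis (Fin d) ℝ (Space d)) : Module.Basis (Fin d) ℝ (Space d) :=
  basisOfLinearIndependentOfCardEqFinrank' (dualBasis E) (linearIndependent_dualBasis E) (by simp)

theorem coe_dual (E : Module.Basis (Fin d) ℝ (Space d)) : ⇑(dual E) = dualBasis E := by
  simp [dual]

theorem dualLattice_eq (E : Module.Basis (Fin d) ℝ (Space d)) :
    dualLattice E = lattice (dual E) := by
  rw [dualLattice, coe_dual]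

theorem exists_inner_eq (E : Module.Basis (Fin d) ℝ (Space d)) {j κ : Space d}
    (hj : j ∈ lattice E) (hκ : κ ∈ lattice (dual E)) :
    ∃ n : ℤ, inner ℝ j κ = n * (2 * Real.pi) := by
  refine Submodule.span_induction (p := fun j _ => ∃ n : ℤ, inner ℝ j κ = n * (2 * Real.pi))
    ?_ ⟨0, by simp⟩ ?_ ?_ hj
  · rintro _ ⟨i, rfl⟩
    refine Submodule.span_induction
      (p := fun κ _ => ∃ n : ℤ, inner ℝ (E i) κ = n * (2 * Real.pi)) ?_ ⟨0, by simp⟩ ?_ ?_ hκ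
    · rintro _ ⟨k, rfl⟩
      rw [coe_dual, inner_dualBasis]
      split_ifs
      · exact ⟨1, by simp⟩
      · exact ⟨0, by simp⟩
    · rintro x y - - ⟨n, hn⟩ ⟨m, hm⟩
      exact ⟨n + m, by rw [inner_add_right, hn, hm]; push_cast; ring⟩
    · rintro a x - ⟨n, hn⟩
      refine ⟨a * n, ?_⟩
      rw [← Int.cast_smul_eq_zsmul ℝ, inner_smul_right, hn]
      push_cast
      ring
  · rintro x y - - ⟨n, hn⟩ ⟨m, hm⟩
    exact ⟨n + m, by rw [inner_add_left, hn, hm]; push_cast; ring⟩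
  · rintro a x - ⟨n, hn⟩
    refine ⟨a * n, ?_⟩
    rw [← Int.cast_smul_eq_zsmul ℝ, inner_smul_left, hn]
    push_cast
    simp
    ring

theorem character_add_left (j k ξ : Space d) :
    character (j + k) ξ = character j ξ * character k ξ := by
  rw [character, character, character, ← Complex.exp_add, inner_add_left]
  push_cast
  ring_nf

theorem character_add_right (j ξ η : Space d) :
    character j (ξ + η) = character j ξ * character j η := by
  rw [character, character, character, ← Complex.exp_add, inner_add_right]
  push_cast
  ring_nf

@[simp]
theorem character_zero_left (ξ : Space d) : character 0 ξ = 1 := by simp [character]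

theorem character_neg_mul (j ξ : Space d) : character (-j) ξ * character j ξ = 1 := by
  rw [← character_add_left]
  simp

theorem character_neg_left (j ξ : Space d) : character (-j) ξ = character j (-ξ) := by
  rw [character, character, inner_neg_left, inner_neg_right]

theorem character_eq_one (E : Module.Basis (Fin d) ℝ (Space d)) {j κ : Space d}
    (hj : j ∈ lattice E) (hκ : κ ∈ lattice (dual E)) : character j κ = 1 := by
  obtain ⟨n, hn⟩ := exists_inner_eq E hj hκ
  rw [character, hn, Complex.exp_eq_one_iff]
  exact ⟨n, by push_cast; ring⟩

theorem isSummableWeight_lattice (b : Module.Basis (Fin d) ℝ (Space d)) :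
    IsSummableWeight fun k : lattice b => 1 + ‖(k : Space d)‖ := by
  refine ⟨fun k => by linarith [norm_nonneg (k : Space d)], ?_⟩
  have : DiscreteTopology (lattice b) :=
    inferInstanceAs (DiscreteTopology (Submodule.span ℤ (Set.range b)))
  refine ⟨Module.finrank ℤ (lattice b) + 1, ?_⟩
  refine Summable.of_norm_bounded_eventually
    (ZLattice.summable_norm_pow_inv (lattice b) _ (Nat.lt_succ_self _)) ?_
  -- The comparison fails at the origin only, where the right side is `0⁻¹ ^ _ = 0`.
  refine (Set.finite_singleton (0 : lattice b)).subset fun k hk => ?_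
  by_contra h0
  refine hk ?_
  have hk0 : 0 < ‖(k : Space d)‖ := norm_pos_iff.2 fun h => h0 (Subtype.ext h)
  change ‖((1 + ‖(k : Space d)‖) ^ _)⁻¹‖ ≤ ‖(k : Space d)‖⁻¹ ^ _
  rw [Real.norm_of_nonneg (by positivity), inv_pow]
  gcongr
  linarith

instance countable_lattice (b : Module.Basis (Fin d) ℝ (Space d)) : Countable (lattice b) := by
  have : DiscreteTopology (lattice b) :=
    inferInstanceAs (DiscreteTopology (Submodule.span ℤ (Set.range b)))
  have : IsZLattice ℝ (lattice b) :=
    inferInstanceAs (IsZLattice ℝ (Submodule.span ℤ (Set.range b)))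
  exact instCountable_of_discrete_submodule (lattice b)

/-- Sum over the lattice of `b` of the translates of `g`. -/
theorem locallySchwartzSeries_translates (b : Module.Basis (Fin d) ℝ (Space d))
    (g : 𝓢(Space d, ℂ)) :
    LocallySchwartzSeries fun (k : lattice b) (ξ : Space d) => g (ξ - k) := by
  intro θ
  obtain ⟨S, hS⟩ := ((rapidlyDecreasing_mulComp θ (ContinuousLinearMap.id ℝ (Space d))).reindex
    fun k : lattice b => (k : Space d)).exists_sum (isSummableWeight_lattice b)
  exact ⟨S g, fun w => hasSum_apply (hS g) w⟩

/-- The sum of the translates of `g` by the lattice of `b`. -/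
def periodization (b : Module.Basis (Fin d) ℝ (Space d)) (g : 𝓢(Space d, ℂ)) (ξ : Space d) : ℂ :=
  ∑' k : lattice b, g (ξ - k)

theorem hasSum_periodization (b : Module.Basis (Fin d) ℝ (Space d)) (g : 𝓢(Space d, ℂ))
    (ξ : Space d) : HasSum (fun k : lattice b => g (ξ - k)) (periodization b g ξ) :=
  ((locallySchwartzSeries_translates b g).summable ξ).hasSum

theorem contDiff_periodization (b : Module.Basis (Fin d) ℝ (Space d)) (g : 𝓢(Space d, ℂ)) :
    ContDiff ℝ ∞ (periodization b g) := (locallySchwartzSeries_translates b g).contDiff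

theorem periodization_add (b : Module.Basis (Fin d) ℝ (Space d)) (g : 𝓢(Space d, ℂ))
    (ξ : Space d) {κ : Space d} (hκ : κ ∈ lattice b) :
    periodization b g (ξ + κ) = periodization b g ξ := by
  rw [periodization, periodization, ← (Equiv.addRight (⟨κ, hκ⟩ : lattice b)).tsum_eq]
  simp

/-- A function whose translates by the lattice of `b` form a partition of unity. -/
structure IsPartition (b : Module.Basis (Fin d) ℝ (Space d)) (ψ : 𝓢(Space d, ℂ)) : Prop where
  hasCompactSupport : HasCompactSupport ψ
  norm_eq : ∀ x, (‖ψ x‖ : ℂ) = ψ x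
  hasSum : ∀ x, HasSum (fun k : lattice b => ψ (x - k)) 1

theorem IsPartition.periodization_eq {b : Module.Basis (Fin d) ℝ (Space d)} {ψ : 𝓢(Space d, ℂ)}
    (hψ : IsPartition b ψ) (x : Space d) : periodization b ψ x = 1 := (hψ.hasSum x).tsum_eq

theorem IsPartition.exists_ne_zero {b : Module.Basis (Fin d) ℝ (Space d)} {ψ : 𝓢(Space d, ℂ)}
    (hψ : IsPartition b ψ) (x : Space d) : ∃ k : lattice b, ψ (x - k) ≠ 0 := by
  by_contra! h
  have := hψ.hasSum x
  simp only [h] at this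
  exact one_ne_zero (this.unique hasSum_zero)

theorem exists_isPartition (b : Module.Basis (Fin d) ℝ (Space d)) : ∃ ψ, IsPartition b ψ := by
  -- `R` bounds the fractional part of every point. So each point has a lattice translate where the
  -- bump `β` is one, and the sum of the translates of `β`, by which it is divided, is at least one.
  set R := ∑ i, ‖b i‖
  have hR : 0 ≤ R := Finset.sum_nonneg fun i _ => norm_nonneg _
  let β : ContDiffBump (0 : Space d) := ⟨R + 1, R + 2, by linarith, by linarith⟩
  have hs : HasCompactSupport fun v => (β v : ℂ) :=
    β.hasCompactSupport.comp_left (g := fun r : ℝ => (r : ℂ)) Complex.ofReal_zero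
  have hcd : ContDiff ℝ ∞ fun v => (β v : ℂ) := Complex.ofRealCLM.contDiff.comp β.contDiff
  let B : 𝓢(Space d, ℂ) := hs.toSchwartzMap hcd
  have hB : ∀ x, B x = (β x : ℂ) := fun x => rfl
  have hsum : ∀ x, Summable fun k : lattice b => β (x - k) := fun x => by
    have := (hasSum_periodization b B x).summable
    simp only [hB] at this
    exact_mod_cast this
  have hP : ∀ x, periodization b B x = ((∑' k : lattice b, β (x - k) : ℝ) : ℂ) := fun x => by
    rw [periodization, Complex.ofReal_tsum]
    rfl
  have hpos : ∀ x, 1 ≤ ∑' k : lattice b, β (x - k) := fun x => by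
    have h1 : β (x - ZSpan.floor b x) = 1 := by
      refine β.one_of_mem_closedBall ?_
      rw [mem_closedBall_zero_iff]
      have : ‖x - ZSpan.floor b x‖ ≤ R := ZSpan.norm_fract_le b x
      change _ ≤ R + 1
      linarith
    calc (1 : ℝ) = β (x - ZSpan.floor b x) := h1.symm
      _ ≤ _ := (hsum x).le_tsum (ZSpan.floor b x : lattice b) fun k _ => β.nonneg
  have hne : ∀ x, periodization b B x ≠ 0 := fun x => by
    rw [hP]
    exact_mod_cast (zero_lt_one.trans_le (hpos x)).ne'
  have hcs : HasCompactSupport fun x => B x * (periodization b B x)⁻¹ := hs.mul_right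
  have hcd' : ContDiff ℝ ∞ fun x => B x * (periodization b B x)⁻¹ :=
    hcd.mul ((contDiff_periodization b B).inv hne)
  refine ⟨hcs.toSchwartzMap hcd', hcs, fun x => ?_, fun x => ?_⟩
  · change ((‖B x * (periodization b B x)⁻¹‖ : ℝ) : ℂ) = B x * (periodization b B x)⁻¹
    have h0 : 0 ≤ β x * (∑' k : lattice b, β (x - k))⁻¹ :=
      mul_nonneg β.nonneg (inv_nonneg.2 (zero_le_one.trans (hpos x)))
    have h1 : B x * (periodization b B x)⁻¹ =
        ((β x * (∑' k : lattice b, β (x - k))⁻¹ : ℝ) : ℂ) := by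
      rw [hP, hB]
      push_cast
      rfl
    rw [h1, Complex.norm_real, Real.norm_of_nonneg h0]
  · have h1 := (hasSum_periodization b B x).mul_right (periodization b B x)⁻¹
    rw [mul_inv_cancel₀ (hne x)] at h1
    have e : (fun k : lattice b => B (x - k) * (periodization b B (x - k))⁻¹) =
        fun k : lattice b => B (x - k) * (periodization b B x)⁻¹ := funext fun k => by
      rw [sub_eq_add_neg, periodization_add b B x (neg_mem k.2)]
    change HasSum (fun k : lattice b => B (x - k) * (periodization b B (x - k))⁻¹) 1
    rw [e]
    exact h1

/-! ### Unfolding of integrals -/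

/-- Multiplication by a character of the Euclidean space. -/
def charMul (j : Space d) : 𝓢(Space d, ℂ) →L[ℂ] 𝓢(Space d, ℂ) := expMul (innerSL ℝ j)

@[simp]
theorem charMul_apply (j : Space d) (f : 𝓢(Space d, ℂ)) (ξ : Space d) :
    charMul j f ξ = character j ξ * f ξ := by
  simp [charMul, character]

theorem hasSum_integral_mul_translates (b : Module.Basis (Fin d) ℝ (Space d))
    (θ g : 𝓢(Space d, ℂ)) :
    HasSum (fun k : lattice b => ∫ ξ, θ ξ * g (ξ - k)) (∫ ξ, θ ξ * periodization b g ξ) := by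
  obtain ⟨S, hS⟩ := ((rapidlyDecreasing_mulComp θ (ContinuousLinearMap.id ℝ (Space d))).reindex
    fun k : lattice b => (k : Space d)).exists_sum (isSummableWeight_lattice b)
  have h1 := (hS g).mapL (SchwartzMap.integralCLM ℂ volume)
  have h2 : ∀ ξ, S g ξ = θ ξ * periodization b g ξ := fun ξ =>
    (hasSum_apply (hS g) ξ).unique ((hasSum_periodization b g ξ).mul_left _)
  simpa [h2] using h1

/-- Both sides unfold to the sum over `k` of `∫ e^{i⟪j, ξ⟫} f(ξ) g(ξ - k) dξ`, after a shift by `k`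
that the character does not notice. When `f` is a partition of unity, this plays the role of
unfolding an integral over a fundamental domain. -/
theorem integral_mul_periodization_comm (E : Module.Basis (Fin d) ℝ (Space d))
    {j : Space d} (hj : j ∈ lattice E) (f g : 𝓢(Space d, ℂ)) :
    ∫ ξ, character j ξ * f ξ * periodization (dual E) g ξ =
      ∫ ξ, character j ξ * g ξ * periodization (dual E) f ξ := by
  have h1 := hasSum_integral_mul_translates (dual E) (charMul j f) g
  have h2 := hasSum_integral_mul_translates (dual E) (charMul j g) f
  simp only [charMul_apply] at h1 h2
  refine h1.unique ?_
  rw [← (Equiv.neg (lattice (dual E))).hasSum_iff] at h2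
  convert h2 using 1
  funext k
  rw [Function.comp_apply, ← integral_sub_right_eq_self
    (fun ξ => character j ξ * g ξ * f (ξ - (Equiv.neg (lattice (dual E)) k : Space d)))
    (k : Space d)]
  congr 1
  ext ξ
  have h3 : character j (ξ - k) = character j ξ := by
    rw [sub_eq_add_neg, character_add_right, character_eq_one E hj (neg_mem k.2), mul_one]
  simp [h3]
  ring

/-! ### Fourier series -/

theorem IsPartition.integral_ne_zero {b : Module.Basis (Fin d) ℝ (Space d)} {ψ : 𝓢(Space d, ℂ)}
    (hψ : IsPartition b ψ) : ∫ ξ, ψ ξ ≠ 0 := by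
  intro h
  have h1 : (fun ξ => ψ ξ) = fun ξ => ((‖ψ ξ‖ : ℝ) : ℂ) := funext fun ξ => (hψ.norm_eq ξ).symm
  rw [h1, integral_complex_ofReal, Complex.ofReal_eq_zero,
    integral_eq_zero_iff_of_nonneg (fun ξ => norm_nonneg _) ψ.integrable.norm] at h
  have h2 := (ψ.continuous.norm.ae_eq_iff_eq volume continuous_zero).1 h
  obtain ⟨k, hk⟩ := hψ.exists_ne_zero 0
  exact hk (norm_eq_zero.1 (congrFun h2 _))

/-- Orthogonality of characters. A translate of `ψ` by `a` also has periodization one, so it yields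
the same integral; but translating multiplies the integral by `character j a`. -/
theorem integral_character_mul_partition (E : Module.Basis (Fin d) ℝ (Space d))
    {ψ : 𝓢(Space d, ℂ)} (hψ : IsPartition (dual E) ψ) {j : Space d} (hj : j ∈ lattice E)
    (hj0 : j ≠ 0) : ∫ ξ, character j ξ * ψ ξ = 0 := by
  have key : ∀ a : Space d, ∫ ξ, character j ξ * ψ ξ =
      character j a * ∫ ξ, character j ξ * ψ ξ := fun a => by
    have hP : ∀ ξ, periodization (dual E) (SchwartzMap.compSubConstCLM ℂ a ψ) ξ = 1 := fun ξ => by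
      rw [← hψ.periodization_eq (ξ - a), periodization, periodization]
      refine tsum_congr fun k => ?_
      rw [SchwartzMap.compSubConstCLM_apply, sub_right_comm]
    have h := integral_mul_periodization_comm E hj ψ (SchwartzMap.compSubConstCLM ℂ a ψ)
    simp only [hP, hψ.periodization_eq, mul_one, SchwartzMap.compSubConstCLM_apply] at h
    rw [← integral_const_mul, h,
      ← integral_add_right_eq_self (fun ξ => character j ξ * ψ (ξ - a)) a]
    congr 1
    ext ξ
    rw [add_sub_cancel_right, character_add_right]
    ring
  have hn : 0 < ‖j‖ := norm_pos_iff.2 hj0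
  -- This translation vector has inner product `π` with `j`, so the character there is `-1`.
  have h1 := key ((Real.pi / ‖j‖ ^ 2) • j)
  have h2 : character j ((Real.pi / ‖j‖ ^ 2) • j) = -1 := by
    rw [character, inner_smul_right, real_inner_self_eq_norm_sq, div_mul_cancel₀ _ (by positivity),
      mul_comm, Complex.exp_pi_mul_I]
  rw [h2] at h1
  linear_combination h1 / 2

/-- The coordinates of a point with respect to the dual basis, modulo integers. -/
def toTorus (E : Module.Basis (Fin d) ℝ (Space d)) (ξ : Space d) : UnitAddTorus (Fin d) :=
  fun k => (((dual E).equivFun ξ k : ℝ) : UnitAddCircle)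

theorem isOpenQuotientMap_toTorus (E : Module.Basis (Fin d) ℝ (Space d)) :
    IsOpenQuotientMap (toTorus E) := by
  have h1 : IsOpenQuotientMap (Pi.map fun (_ : Fin d) (x : ℝ) => (x : UnitAddCircle)) :=
    IsOpenQuotientMap.piMap fun _ => QuotientAddGroup.isOpenQuotientMap_mk
  exact h1.comp (dual E).equivFun.toContinuousLinearEquiv.toHomeomorph.isOpenQuotientMap

theorem mFourier_toTorus (E : Module.Basis (Fin d) ℝ (Space d)) (n : Fin d → ℤ) (ξ : Space d) :
    UnitAddTorus.mFourier n (toTorus E ξ) = character (∑ k, n k • E k) ξ := by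
  have h1 : ∀ k, inner ℝ (E k) ξ = 2 * Real.pi * (dual E).equivFun ξ k := fun k => by
    conv_lhs => rw [← (dual E).sum_equivFun ξ]
    simp [inner_sum, inner_smul_right, coe_dual, inner_dualBasis, mul_comm]
  simp only [UnitAddTorus.mFourier, ContinuousMap.coe_mk, toTorus, fourier_coe_apply]
  rw [← Complex.exp_sum, character]
  congr 1
  rw [sum_inner]
  push_cast
  rw [Finset.mul_sum]
  refine Finset.sum_congr rfl fun k _ => ?_
  rw [← Int.cast_smul_eq_zsmul ℝ, inner_smul_left, h1]
  simp
  ring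

theorem exists_mem_lattice_of_toTorus_eq (E : Module.Basis (Fin d) ℝ (Space d)) {ξ η : Space d}
    (h : toTorus E ξ = toTorus E η) : ξ - η ∈ lattice (dual E) := by
  have h1 : ∀ k, ∃ n : ℤ, (dual E).equivFun (ξ - η) k = n := fun k => by
    have := congrFun h k
    simp only [toTorus] at this
    rw [← sub_eq_zero, ← AddCircle.coe_sub, AddCircle.coe_eq_zero_iff] at this
    obtain ⟨n, hn⟩ := this
    exact ⟨n, by rw [map_sub, Pi.sub_apply, ← hn]; simp⟩
  choose n hn using h1
  rw [← (dual E).sum_equivFun (ξ - η)]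
  refine Submodule.sum_mem _ fun k _ => ?_
  rw [hn, Int.cast_smul_eq_zsmul]
  exact Submodule.smul_mem _ _ (Submodule.subset_span ⟨k, rfl⟩)

theorem sum_zsmul_mem_lattice (b : Module.Basis (Fin d) ℝ (Space d)) (n : Fin d → ℤ) :
    ∑ k, n k • b k ∈ lattice b :=
  Submodule.sum_mem _ fun k _ => Submodule.smul_mem _ _ (Submodule.subset_span ⟨k, rfl⟩)

/-- A continuous periodic function whose Fourier coefficients vanish is zero. -/
theorem eq_zero_of_integral_character_eq_zero (E : Module.Basis (Fin d) ℝ (Space d))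
    {ψ : 𝓢(Space d, ℂ)} (hψ : IsPartition (dual E) ψ) {H : Space d → ℂ} (hH : Continuous H)
    (hper : ∀ ξ, ∀ κ ∈ lattice (dual E), H (ξ + κ) = H ξ)
    (h0 : ∀ j ∈ lattice E, ∫ ξ, character j ξ * (ψ ξ * H ξ) = 0) (ξ : Space d) : H ξ = 0 := by
  have hq := isOpenQuotientMap_toTorus E
  have hfac : ∀ ξ η, toTorus E ξ = toTorus E η → H ξ = H η := fun ξ η h => by
    have := hper η _ (exists_mem_lattice_of_toTorus_eq E h)
    rw [add_sub_cancel] at this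
    exact this
  let h : C(UnitAddTorus (Fin d), ℂ) :=
    (hq.isQuotientMap.lift (f := ⟨_, hq.continuous⟩) ⟨H, hH⟩ hfac)
  have hh : ∀ ξ, h (toTorus E ξ) = H ξ := fun ξ =>
    DFunLike.congr_fun (hq.isQuotientMap.lift_comp (f := ⟨_, hq.continuous⟩) ⟨H, hH⟩ hfac) ξ
  have hint : ∀ f : C(UnitAddTorus (Fin d), ℂ), Integrable fun ξ => f (toTorus E ξ) * ψ ξ :=
    fun f => ψ.integrable.bdd_mul (c := ‖f‖)
      (f.continuous.comp hq.continuous).aestronglyMeasurable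
      (Filter.Eventually.of_forall fun ξ => f.norm_coe_le_norm _)
  let T : C(UnitAddTorus (Fin d), ℂ) →L[ℂ] ℂ := LinearMap.mkContinuous
    { toFun := fun f => ∫ ξ, f (toTorus E ξ) * ψ ξ
      map_add' := fun f g => by
        rw [← integral_add (hint f) (hint g)]
        simp [add_mul]
      map_smul' := fun c f => by
        rw [RingHom.id_apply, smul_eq_mul, ← integral_const_mul]
        simp [mul_assoc] } (∫ ξ, ‖ψ ξ‖) fun f => by
      change ‖∫ ξ, f (toTorus E ξ) * ψ ξ‖ ≤ _
      rw [mul_comm, ← integral_const_mul]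
      refine norm_integral_le_of_norm_le (ψ.integrable.norm.const_mul _)
        (Filter.Eventually.of_forall fun ξ => ?_)
      rw [norm_mul]
      exact mul_le_mul_of_nonneg_right (f.norm_coe_le_norm _) (norm_nonneg _)
  let M : C(UnitAddTorus (Fin d), ℂ) →L[ℂ] ℂ := T.comp (ContinuousLinearMap.mul ℂ _ h)
  have hM : ∀ f, M f = ∫ ξ, f (toTorus E ξ) * (ψ ξ * H ξ) := fun f => by
    change ∫ ξ, (h * f) (toTorus E ξ) * ψ ξ = _
    congr 1
    ext ξ
    rw [ContinuousMap.mul_apply, hh]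
    ring
  -- `M` kills every monomial by hypothesis, hence, by density of trigonometric polynomials, every
  -- continuous function on the torus.
  have hker : ∀ f, M f = 0 := by
    have h1 : Submodule.span ℂ (Set.range (UnitAddTorus.mFourier (d := Fin d))) ≤
        LinearMap.ker M.toLinearMap := by
      rw [Submodule.span_le]
      rintro _ ⟨n, rfl⟩
      change M _ = 0
      rw [hM]
      simp only [mFourier_toTorus]
      exact h0 _ (sum_zsmul_mem_lattice E n)
    have h2 := Submodule.topologicalClosure_minimal _ h1 M.isClosed_ker
    rw [UnitAddTorus.span_mFourier_closure_eq_top] at h2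
    exact fun f => h2 (Submodule.mem_top (x := f))
  -- Testing against the conjugate gives `∫ ψ |H|² = 0` with a nonnegative continuous integrand. So
  -- `H` vanishes wherever `ψ` does not, and every point has a lattice translate of that kind.
  have h1 := hker (star h)
  rw [hM] at h1
  have h2 : (fun ξ => (star h) (toTorus E ξ) * (ψ ξ * H ξ)) =
      fun ξ => ((‖ψ ξ‖ * ‖H ξ‖ ^ 2 : ℝ) : ℂ) := by
    ext ξ
    rw [ContinuousMap.star_apply, hh, mul_left_comm]
    push_cast
    rw [hψ.norm_eq, ← Complex.conj_mul']
    rfl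
  have hint2 := hint (h * star h)
  have h3 : (fun ξ => (h * star h) (toTorus E ξ) * ψ ξ) =
      fun ξ => ((‖ψ ξ‖ * ‖H ξ‖ ^ 2 : ℝ) : ℂ) := by
    rw [← h2]
    ext ξ
    rw [ContinuousMap.mul_apply, hh]
    ring
  rw [h3] at hint2
  have hint3 : Integrable fun ξ => ‖ψ ξ‖ * ‖H ξ‖ ^ 2 := by
    exact hint2.re
  rw [h2, integral_complex_ofReal, Complex.ofReal_eq_zero, integral_eq_zero_iff_of_nonneg
    (fun ξ => by positivity) hint3] at h1
  have h4 := ((ψ.continuous.norm.mul (hH.norm.pow 2)).ae_eq_iff_eq volume continuous_zero).1 h1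
  obtain ⟨k, hk⟩ := hψ.exists_ne_zero ξ
  have h5 : ‖ψ (ξ - k)‖ * ‖H (ξ - k)‖ ^ 2 = 0 := congrFun h4 (ξ - k)
  have h6 : H (ξ - k) = 0 := by simpa [hk] using h5
  rw [sub_eq_add_neg, hper _ _ (neg_mem k.2)] at h6
  exact h6

/-- The integral of `g` against the character of index `-j`, divided by the volume of a fundamental
domain that is computed with the partition of unity `ψ`. -/
def fourierCoeff (ψ g : 𝓢(Space d, ℂ)) (j : Space d) : ℂ :=
  (∫ ξ, ψ ξ)⁻¹ * ∫ ξ, character (-j) ξ * g ξ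

theorem norm_integral_character_mul_le (g : 𝓢(Space d, ℂ)) (N : ℕ) :
    ∃ C : ℝ, ∀ j : Space d, ‖∫ ξ, character j ξ * g ξ‖ ≤ C * ((1 + ‖j‖) ^ N)⁻¹ := by
  -- A full Fourier integral is a partial one whose parameter space `Space 0` is a point.
  obtain ⟨I, C, hC, h⟩ := partialFourier_bound_zero (d := d) (Space 0) ℂ N 0
  obtain ⟨Φ, hΦ⟩ : ∃ Φ : 𝓢(Space 0 × Space d, ℂ), ∀ ξ, Φ (0, ξ) = g ξ := by
    refine ⟨compAffine (ContinuousLinearMap.snd ℝ (Space 0) (Space d)) 0 (fun w => ?_) g,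
      fun ξ => by simp⟩
    simp [Prod.norm_def, Subsingleton.elim w.1 0]
  refine ⟨C * I.sup (schwartzSeminormFamily ℂ (Space 0 × Space d) ℂ) Φ, fun j => ?_⟩
  rw [← div_eq_mul_inv, le_div_iff₀' (by positivity)]
  simpa [hΦ] using h j Φ 0

theorem summable_norm_fourierCoeff (b : Module.Basis (Fin d) ℝ (Space d)) (ψ g : 𝓢(Space d, ℂ)) :
    Summable fun j : lattice b => ‖fourierCoeff ψ g j‖ := by
  obtain ⟨N, hN⟩ := (isSummableWeight_lattice b).summable
  obtain ⟨C, hC⟩ := norm_integral_character_mul_le g N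
  refine Summable.of_nonneg_of_le (fun _ => norm_nonneg _) (fun j => ?_)
    (hN.mul_left (‖(∫ ξ, ψ ξ)⁻¹‖ * C))
  rw [fourierCoeff, norm_mul, mul_assoc]
  gcongr
  simpa using hC (-j)

theorem integral_character_mul_periodization (E : Module.Basis (Fin d) ℝ (Space d))
    {ψ : 𝓢(Space d, ℂ)} (hψ : IsPartition (dual E) ψ) (g : 𝓢(Space d, ℂ)) {j : Space d}
    (hj : j ∈ lattice E) :
    ∫ ξ, character j ξ * (ψ ξ * periodization (dual E) g ξ) = ∫ ξ, character j ξ * g ξ := by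
  simpa only [hψ.periodization_eq, mul_one, mul_assoc] using
    integral_mul_periodization_comm E hj ψ g

/-- The Fourier series of the periodization of `g`. -/
def fourierSeries (E : Module.Basis (Fin d) ℝ (Space d)) (ψ g : 𝓢(Space d, ℂ)) (ξ : Space d) : ℂ :=
  ∑' j : lattice E, fourierCoeff ψ g j * character j ξ

theorem norm_fourierCoeff_mul_character (ψ g : 𝓢(Space d, ℂ)) (j ξ : Space d) :
    ‖fourierCoeff ψ g j * character j ξ‖ = ‖fourierCoeff ψ g j‖ := by
  rw [norm_mul, norm_character, mul_one]

theorem hasSum_fourierSeries (E : Module.Basis (Fin d) ℝ (Space d)) (ψ g : 𝓢(Space d, ℂ))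
    (ξ : Space d) :
    HasSum (fun j : lattice E => fourierCoeff ψ g j * character j ξ) (fourierSeries E ψ g ξ) :=
  (Summable.of_norm_bounded (summable_norm_fourierCoeff E ψ g) fun j =>
    (norm_fourierCoeff_mul_character ψ g j ξ).le).hasSum

theorem continuous_fourierSeries (E : Module.Basis (Fin d) ℝ (Space d)) (ψ g : 𝓢(Space d, ℂ)) :
    Continuous (fourierSeries E ψ g) :=
  continuous_tsum (fun _ => continuous_const.mul (continuous_character _))
    (summable_norm_fourierCoeff E ψ g) fun _ ξ => (norm_fourierCoeff_mul_character ψ g _ ξ).le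

theorem norm_fourierSeries_le (E : Module.Basis (Fin d) ℝ (Space d)) (ψ g : 𝓢(Space d, ℂ))
    (ξ : Space d) : ‖fourierSeries E ψ g ξ‖ ≤ ∑' j : lattice E, ‖fourierCoeff ψ g j‖ := by
  have h := norm_tsum_le_tsum_norm (f := fun j : lattice E => fourierCoeff ψ g j * character j ξ)
    (by simpa only [norm_fourierCoeff_mul_character] using summable_norm_fourierCoeff E ψ g)
  simp only [norm_fourierCoeff_mul_character] at h
  exact h

theorem fourierSeries_add (E : Module.Basis (Fin d) ℝ (Space d)) (ψ g : 𝓢(Space d, ℂ))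
    (ξ : Space d) {κ : Space d} (hκ : κ ∈ lattice (dual E)) :
    fourierSeries E ψ g (ξ + κ) = fourierSeries E ψ g ξ := by
  refine tsum_congr fun j => ?_
  rw [character_add_right, character_eq_one E j.2 hκ, mul_one]

theorem integrable_character_mul (j : Space d) (g : 𝓢(Space d, ℂ)) :
    Integrable fun ξ => character j ξ * g ξ := by
  refine (charMul j g).integrable.congr (Filter.Eventually.of_forall fun ξ => ?_)
  simp

theorem integral_character_mul_fourierSeries (E : Module.Basis (Fin d) ℝ (Space d))
    {ψ : 𝓢(Space d, ℂ)} (hψ : IsPartition (dual E) ψ) (g : 𝓢(Space d, ℂ)) {k : Space d}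
    (hk : k ∈ lattice E) :
    ∫ ξ, character k ξ * (ψ ξ * fourierSeries E ψ g ξ) = ∫ ξ, character k ξ * g ξ := by
  have h1 : ∀ j : lattice E, (fun ξ => character k ξ *
      (ψ ξ * (fourierCoeff ψ g j * character j ξ))) =
      fun ξ => fourierCoeff ψ g j * (character (k + (j : Space d)) ξ * ψ ξ) := fun j => by
    ext ξ
    rw [character_add_left]
    ring
  have h2 : HasSum (fun j : lattice E => ∫ ξ, character k ξ *
      (ψ ξ * (fourierCoeff ψ g j * character j ξ)))
      (∫ ξ, ∑' j : lattice E, character k ξ *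
      (ψ ξ * (fourierCoeff ψ g j * character j ξ))) := by
    refine hasSum_integral_of_summable_integral_norm (fun j => ?_) ?_
    · rw [h1]
      exact (integrable_character_mul _ ψ).const_mul _
    · simp only [norm_mul, norm_character, one_mul, mul_one, integral_mul_const]
      exact (summable_norm_fourierCoeff E ψ g).mul_left _
  simp only [tsum_mul_left] at h2
  refine h2.unique ?_
  -- By orthogonality only the term of index `-k` survives.
  have h3 := hasSum_ite_eq (⟨-k, neg_mem hk⟩ : lattice E) (∫ ξ, character k ξ * g ξ)
  convert h3 using 1
  funext j
  rw [h1, integral_const_mul]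
  split_ifs with hj
  · have hj' : (j : Space d) = -k := congrArg Subtype.val hj
    rw [hj', add_neg_cancel, fourierCoeff, neg_neg]
    simp only [character_zero_left, one_mul]
    rw [mul_right_comm, inv_mul_cancel₀ hψ.integral_ne_zero, one_mul]
  · rw [integral_character_mul_partition E hψ (add_mem hk j.2), mul_zero]
    intro h
    exact hj (Subtype.ext (eq_neg_of_add_eq_zero_right h))

/-- **Poisson summation.** -/
theorem fourierSeries_eq_periodization (E : Module.Basis (Fin d) ℝ (Space d))
    {ψ : 𝓢(Space d, ℂ)} (hψ : IsPartition (dual E) ψ) (g : 𝓢(Space d, ℂ)) (ξ : Space d) :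
    fourierSeries E ψ g ξ = periodization (dual E) g ξ := by
  rw [← sub_eq_zero]
  -- Both sides are continuous and periodic with the same Fourier coefficients, so uniqueness
  -- applies to their difference.
  refine eq_zero_of_integral_character_eq_zero E hψ
    (H := fun ξ => fourierSeries E ψ g ξ - periodization (dual E) g ξ)
    ((continuous_fourierSeries E ψ g).sub (contDiff_periodization (dual E) g).continuous)
    (fun ξ κ hκ => by rw [periodization_add _ _ _ hκ, fourierSeries_add E ψ g ξ hκ])
    (fun j hj => ?_) ξ
  have hi1 : Integrable fun ξ => character j ξ * (ψ ξ * fourierSeries E ψ g ξ) := by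
    have := (integrable_character_mul j ψ).bdd_mul
      (continuous_fourierSeries E ψ g).aestronglyMeasurable
      (Filter.Eventually.of_forall (norm_fourierSeries_le E ψ g))
    refine this.congr (Filter.Eventually.of_forall fun ξ => ?_)
    change fourierSeries E ψ g ξ * (character j ξ * ψ ξ) = _
    ring
  have hi2 : Integrable fun ξ => character j ξ * (ψ ξ * periodization (dual E) g ξ) := by
    obtain ⟨G, hG⟩ := (locallySchwartzSeries_translates (dual E) g).exists_eq (charMul j ψ)
    refine G.integrable.congr (Filter.Eventually.of_forall fun ξ => ?_)
    simp only [hG, charMul_apply, mul_assoc]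
    rfl
  simp only [mul_sub]
  rw [integral_sub hi1 hi2, integral_character_mul_fourierSeries E hψ g hj,
    integral_character_mul_periodization E hψ g hj, sub_self]

end

section

/-! ### The topology of smooth functions -/

section SmoothTopology

variable {Y W : Type*} [TopologicalSpace Y] [NormedAddCommGroup W] [NormedSpace ℝ W]

/-- The change of the function is controlled by a seminorm uniformly in the point; the change of the
point concerns one fixed function. -/
theorem continuous_iteratedFDeriv_eval (n : ℕ) :
    Continuous fun p : 𝓢(W, ℂ) × W => iteratedFDeriv ℝ n p.1 p.2 := by
  rw [continuous_iff_continuousAt]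
  rintro ⟨Ψ₀, w₀⟩
  have h1 : Filter.Tendsto (fun p : 𝓢(W, ℂ) × W => SchwartzMap.seminorm ℂ 0 n (p.1 - Ψ₀) +
      ‖iteratedFDeriv ℝ n Ψ₀ p.2 - iteratedFDeriv ℝ n Ψ₀ w₀‖) (nhds (Ψ₀, w₀)) (nhds 0) := by
    have hc1 : Continuous fun p : 𝓢(W, ℂ) × W => SchwartzMap.seminorm ℂ 0 n (p.1 - Ψ₀) :=
      ((schwartz_withSeminorms ℂ W ℂ).continuous_seminorm (0, n)).comp
        (continuous_fst.sub continuous_const)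
    have hc2 : Continuous fun p : 𝓢(W, ℂ) × W =>
        ‖iteratedFDeriv ℝ n Ψ₀ p.2 - iteratedFDeriv ℝ n Ψ₀ w₀‖ := by
      have h : Continuous (iteratedFDeriv ℝ n Ψ₀) :=
        (Ψ₀.smooth ⊤).continuous_iteratedFDeriv (by exact_mod_cast le_top)
      simp only [← dist_eq_norm]
      exact (h.comp continuous_snd).dist continuous_const
    have hz : SchwartzMap.seminorm ℂ 0 n (Ψ₀ - Ψ₀) +
        ‖iteratedFDeriv ℝ n Ψ₀ w₀ - iteratedFDeriv ℝ n Ψ₀ w₀‖ = 0 := by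
      rw [sub_self, sub_self, map_zero, norm_zero, add_zero]
    rw [← hz]
    exact (hc1.add hc2).tendsto (Ψ₀, w₀)
  rw [ContinuousAt, tendsto_iff_norm_sub_tendsto_zero]
  refine squeeze_zero (fun _ => norm_nonneg _) (fun p => ?_) h1
  have h2 : iteratedFDeriv ℝ n (p.1 - Ψ₀ : 𝓢(W, ℂ)) p.2 =
      iteratedFDeriv ℝ n p.1 p.2 - iteratedFDeriv ℝ n Ψ₀ p.2 := by
    have := iteratedFDeriv_sub_apply (𝕜 := ℝ) (i := n) (x := p.2)
      ((p.1.smooth n).contDiffAt) ((Ψ₀.smooth n).contDiffAt)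
    exact this
  have h3 := SchwartzMap.norm_iteratedFDeriv_le_seminorm ℂ (p.1 - Ψ₀) n p.2
  rw [h2] at h3
  calc _ ≤ ‖iteratedFDeriv ℝ n p.1 p.2 - iteratedFDeriv ℝ n Ψ₀ p.2‖ +
        ‖iteratedFDeriv ℝ n Ψ₀ p.2 - iteratedFDeriv ℝ n Ψ₀ w₀‖ :=
      norm_sub_le_norm_sub_add_norm_sub ..
    _ ≤ _ := by gcongr

/-- Continuity into the compact-open topology follows from joint continuity of the derivatives in
`(y, w)`. That is local in `w`, so `T` may be replaced by `θ T` with `θ` equal to one near the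
point. -/
theorem continuous_smoothFunction [FiniteDimensional ℝ W] {T : Y → SmoothFunction W}
    (h : ∀ θ : 𝓢(W, ℂ), ∃ M : Y → 𝓢(W, ℂ), Continuous M ∧ ∀ y w, M y w = θ w * T y w) :
    Continuous T := by
  refine continuous_iInf_rng.2 fun n => continuous_induced_rng.2 ?_
  refine ContinuousMap.continuous_of_continuous_uncurry _ (continuous_iff_continuousAt.2 ?_)
  rintro ⟨y₀, w₀⟩
  obtain ⟨θ, -, hθ⟩ := exists_schwartz_eventually_eq_one w₀
  obtain ⟨M, hM, hMT⟩ := h θ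
  have h1 : Continuous fun p : Y × W => iteratedFDeriv ℝ n (M p.1) p.2 :=
    (continuous_iteratedFDeriv_eval n).comp ((hM.comp continuous_fst).prodMk continuous_snd)
  refine h1.continuousAt.congr ?_
  have h2 : ∀ᶠ p : Y × W in nhds (y₀, w₀), ∀ᶠ v in nhds p.2, θ v = 1 :=
    continuous_snd.continuousAt.eventually (eventually_eventually_nhds.2 hθ)
  filter_upwards [h2] with p hp
  refine Filter.EventuallyEq.eq_of_nhds (Filter.EventuallyEq.iteratedFDeriv ℝ ?_ n)
  filter_upwards [hp] with v hv
  rw [hMT, hv, one_mul]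

/-- The product of a compactly supported Schwartz function and a smooth function. -/
def mulSmooth (θ : 𝓢(W, ℂ)) (hθ : HasCompactSupport θ) (F : SmoothFunction W) : 𝓢(W, ℂ) :=
  HasCompactSupport.toSchwartzMap (f := fun w => θ w * F w) hθ.mul_right
    ((θ.smooth ⊤).mul F.contDiff)

@[simp]
theorem mulSmooth_apply (θ : 𝓢(W, ℂ)) (hθ : HasCompactSupport θ) (F : SmoothFunction W) (w : W) :
    mulSmooth θ hθ F w = θ w * F w := rfl

theorem continuous_derivMap (n : ℕ) :
    Continuous (SmoothFunction.derivMap n : SmoothFunction W → C(W, W [×n]→L[ℝ] ℂ)) :=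
  continuous_iInf_dom continuous_induced_dom

theorem norm_iteratedFDeriv_mul_le_of_tsupport (θ : 𝓢(W, ℂ)) {G : W → ℂ} (hG : ContDiff ℝ ∞ G)
    {δ : ℝ} (k n : ℕ) (h : ∀ m ≤ n, ∀ w ∈ tsupport θ, ‖iteratedFDeriv ℝ m G w‖ ≤ δ)
    (w : W) : ‖w‖ ^ k * ‖iteratedFDeriv ℝ n (fun w => θ w * G w) w‖ ≤
      (∑ i ∈ Finset.range (n + 1), n.choose i * SchwartzMap.seminorm ℂ k i θ) * δ := by
  have hmul := norm_iteratedFDeriv_mul_le (𝕜 := ℝ) (N := ∞) (n := n) (x := w)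
    (f := θ) (g := G) (θ.smooth ⊤) hG (by exact_mod_cast le_top)
  calc _ ≤ ‖w‖ ^ k * ∑ i ∈ Finset.range (n + 1), n.choose i * ‖iteratedFDeriv ℝ i θ w‖ *
          ‖iteratedFDeriv ℝ (n - i) G w‖ := by gcongr
    _ = ∑ i ∈ Finset.range (n + 1), n.choose i * (‖w‖ ^ k * ‖iteratedFDeriv ℝ i θ w‖ *
          ‖iteratedFDeriv ℝ (n - i) G w‖) := by
        rw [Finset.mul_sum]
        exact Finset.sum_congr rfl fun i _ => by ring
    _ ≤ ∑ i ∈ Finset.range (n + 1), n.choose i * (SchwartzMap.seminorm ℂ k i θ * δ) := by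
        refine Finset.sum_le_sum fun i _ => mul_le_mul_of_nonneg_left ?_ (Nat.cast_nonneg _)
        by_cases hw : w ∈ tsupport θ
        · exact mul_le_mul (SchwartzMap.le_seminorm ℂ k i θ w) (h _ (Nat.sub_le n i) w hw)
            (norm_nonneg _) (apply_nonneg _ _)
        · have h0 : iteratedFDeriv ℝ i θ w = 0 :=
            image_eq_zero_of_notMem_tsupport fun h' => hw (tsupport_iteratedFDeriv_subset i h')
          rw [h0, norm_zero, mul_zero, zero_mul]
          -- The sign of `δ` is not assumed: a point of the support forces `0 ≤ δ`, and without one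
          -- `θ` is zero.
          by_cases hne : (tsupport θ).Nonempty
          · obtain ⟨v, hv⟩ := hne
            exact mul_nonneg (apply_nonneg _ _) ((norm_nonneg _).trans (h 0 (Nat.zero_le n) v hv))
          · have hθ0 : θ = 0 := by
              ext v
              exact image_eq_zero_of_notMem_tsupport fun hv => hne ⟨v, hv⟩
            simp [hθ0]
    _ = _ := by
        rw [Finset.sum_mul]
        exact Finset.sum_congr rfl fun i _ => by ring

theorem continuous_mulSmooth (θ : 𝓢(W, ℂ)) (hθ : HasCompactSupport θ) :
    Continuous (mulSmooth θ hθ) := by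
  refine continuous_iff_continuousAt.2 fun F₀ => ?_
  rw [ContinuousAt, (schwartz_withSeminorms ℂ W ℂ).tendsto_nhds]
  rintro ⟨k, n⟩ ε hε
  set S := ∑ i ∈ Finset.range (n + 1), (n.choose i : ℝ) * SchwartzMap.seminorm ℂ k i θ
  have hS : 0 ≤ S := Finset.sum_nonneg fun i _ =>
    mul_nonneg (Nat.cast_nonneg _) (apply_nonneg _ _)
  set δ := ε / (2 * (S + 1))
  have hδ : 0 < δ := by positivity
  have hev : ∀ m, ∀ᶠ F in nhds F₀, ∀ w ∈ tsupport θ,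
      dist (SmoothFunction.derivMap m F₀ w) (SmoothFunction.derivMap m F w) < δ := fun m =>
    Metric.tendstoUniformlyOn_iff.1
      (ContinuousMap.tendsto_iff_forall_isCompact_tendstoUniformlyOn.1
        ((continuous_derivMap m).tendsto F₀) (tsupport θ) hθ) δ hδ
  have hall := (Filter.eventually_all_finset (Finset.range (n + 1))).2 fun m _ => hev m
  filter_upwards [hall] with F hF
  have hb : SchwartzMap.seminorm ℂ k n (mulSmooth θ hθ F - mulSmooth θ hθ F₀) ≤ S * δ := by
    refine SchwartzMap.seminorm_le_bound ℂ k n _ (by positivity) fun w => ?_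
    have e : ((mulSmooth θ hθ F - mulSmooth θ hθ F₀ : 𝓢(W, ℂ)) : W → ℂ) =
        fun w => θ w * (F w - F₀ w) := by
      ext w
      simp [mul_sub]
    rw [e]
    refine norm_iteratedFDeriv_mul_le_of_tsupport θ (F.contDiff.sub F₀.contDiff) k n
      (fun m hm w hw => ?_) w
    have h1 : iteratedFDeriv ℝ m (fun w => F w - F₀ w) w =
        iteratedFDeriv ℝ m F w - iteratedFDeriv ℝ m F₀ w :=
      iteratedFDeriv_sub_apply (𝕜 := ℝ) (i := m) (x := w)
        ((F.contDiff.of_le (by exact_mod_cast le_top)).contDiffAt)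
        ((F₀.contDiff.of_le (by exact_mod_cast le_top)).contDiffAt)
    rw [h1, ← dist_eq_norm, dist_comm]
    exact (hF m (Finset.mem_range.2 (Nat.lt_succ_of_le hm)) w hw).le
  refine hb.trans_lt ?_
  calc S * δ ≤ (S + 1) * δ := by gcongr; linarith
    _ = ε / 2 := by simp only [δ]; field_simp
    _ < ε := by linarith

end SmoothTopology

/-! ### The Zak transform of Schwartz functions -/

variable {d : ℕ}

theorem temperatelyGrowing_modulate :
    TemperatelyGrowing (fun k : Space d => 1 + ‖k‖) (modulate : Space d → _) := by
  let ℓ : Space d → (Phase d →L[ℝ] ℝ) := fun k =>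
    (innerSL ℝ k).comp (ContinuousLinearMap.snd ℝ (Space d) (Space d))
  have h1 := (temperatelyGrowing_expMul (V := Phase d)).reindex ℓ
  have h2 : (fun k => expMul (ℓ k)) = (modulate : Space d → _) := rfl
  rw [h2] at h1
  refine h1.mono (fun k => by simp only [Function.comp_apply]; positivity) zero_le_one fun k => ?_
  have h3 : ‖ℓ k‖ ≤ ‖k‖ := by
    refine (ContinuousLinearMap.opNorm_comp_le _ _).trans ?_
    rw [innerSL_apply_norm]
    exact mul_le_of_le_one_right (norm_nonneg _) (ContinuousLinearMap.norm_snd_le ..)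
  simpa using h3

/-- `Z f` itself does not decay, but the cutoff `θ` makes the translates of `f` rapidly decreasing
in `j`, while modulations grow only polynomially. -/
theorem exists_hasSum_mul_zakTerm (E : Module.Basis (Fin d) ℝ (Space d)) (θ : 𝓢(Phase d, ℂ)) :
    ∃ S : 𝓢(Space d, ℂ) →L[ℂ] 𝓢(Phase d, ℂ), ∀ f, HasSum (fun j : lattice E =>
      modulate j (mulComp θ (ContinuousLinearMap.fst ℝ (Space d) (Space d)) j f)) (S f) :=
  ((temperatelyGrowing_modulate.reindex fun j : lattice E => (j : Space d)).comp_rapid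
    ((rapidlyDecreasing_mulComp θ (ContinuousLinearMap.fst ℝ (Space d) (Space d))).reindex
      fun j : lattice E => (j : Space d)) fun j => by
        simp only [Function.comp_apply]; positivity).exists_sum (isSummableWeight_lattice E)

/-- The operator `f ↦ θ · Z f`. -/
def mulZak (E : Module.Basis (Fin d) ℝ (Space d)) (θ : 𝓢(Phase d, ℂ)) :
    𝓢(Space d, ℂ) →L[ℂ] 𝓢(Phase d, ℂ) := (exists_hasSum_mul_zakTerm E θ).choose

theorem hasSum_mulZak (E : Module.Basis (Fin d) ℝ (Space d)) (θ : 𝓢(Phase d, ℂ))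
    (f : 𝓢(Space d, ℂ)) : HasSum (fun j : lattice E =>
      modulate j (mulComp θ (ContinuousLinearMap.fst ℝ (Space d) (Space d)) j f))
      (mulZak E θ f) := (exists_hasSum_mul_zakTerm E θ).choose_spec f

theorem modulate_mulComp_apply (θ : 𝓢(Phase d, ℂ)) (f : 𝓢(Space d, ℂ)) (j : Space d)
    (p : Phase d) : modulate j (mulComp θ (ContinuousLinearMap.fst ℝ (Space d) (Space d)) j f) p =
      θ p * zakTerm f p.1 p.2 j := by
  rw [← Prod.mk.eta (p := p), modulate_apply, mulComp_apply, zakTerm]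
  simp
  ring

theorem locallySchwartzSeries_zakTerm (E : Module.Basis (Fin d) ℝ (Space d))
    (f : 𝓢(Space d, ℂ)) :
    LocallySchwartzSeries fun (j : lattice E) (p : Phase d) => zakTerm f p.1 p.2 j := by
  refine fun θ => ⟨mulZak E θ f, fun p => ?_⟩
  simpa only [modulate_mulComp_apply] using hasSum_apply (hasSum_mulZak E θ f) p

theorem hasSum_zak (E : Module.Basis (Fin d) ℝ (Space d)) (f : 𝓢(Space d, ℂ)) (p : Phase d) :
    HasSum (fun j : lattice E => zakTerm f p.1 p.2 j) (zak E f p) :=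
  ((locallySchwartzSeries_zakTerm E f).summable p).hasSum

@[simp]
theorem mulZak_apply (E : Module.Basis (Fin d) ℝ (Space d)) (θ : 𝓢(Phase d, ℂ))
    (f : 𝓢(Space d, ℂ)) (p : Phase d) : mulZak E θ f p = θ p * zak E f p := by
  have h := hasSum_apply (hasSum_mulZak E θ f) p
  simp only [modulate_mulComp_apply] at h
  exact h.unique ((hasSum_zak E f p).mul_left _)

theorem contDiff_zak (E : Module.Basis (Fin d) ℝ (Space d)) (f : 𝓢(Space d, ℂ)) :
    ContDiff ℝ ∞ (zak E f) := (locallySchwartzSeries_zakTerm E f).contDiff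

theorem isQuasiPeriodic_zak (E : Module.Basis (Fin d) ℝ (Space d)) (f : 𝓢(Space d, ℂ)) :
    IsQuasiPeriodic E (zak E f) := by
  refine ⟨fun k hk x ξ => ?_, fun κ hκ x ξ => ?_⟩
  · rw [zak, ← (Equiv.addRight (⟨k, hk⟩ : lattice E)).tsum_eq, zak, ← tsum_mul_left]
    refine tsum_congr fun j => ?_
    simp only [zakTerm, Equiv.coe_addRight, Submodule.coe_add, character_add_left,
      add_sub_add_right_eq_sub]
    ring
  · rw [dualLattice_eq] at hκ
    refine tsum_congr fun j => ?_
    simp only [zakTerm]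
    rw [character_add_right, character_eq_one E j.2 hκ, mul_one]

/-- The Zak transform as a map to the quasi-periodic smooth functions. -/
def zakSmooth (E : Module.Basis (Fin d) ℝ (Space d)) (f : 𝓢(Space d, ℂ)) :
    QuasiPeriodicSmooth E := ⟨⟨zak E f, contDiff_zak E f⟩, isQuasiPeriodic_zak E f⟩

theorem continuous_zakSmooth (E : Module.Basis (Fin d) ℝ (Space d)) :
    Continuous (zakSmooth E) := by
  refine Continuous.subtype_mk (continuous_smoothFunction (T := fun f : 𝓢(Space d, ℂ) =>
    (⟨zak E f, contDiff_zak E f⟩ : SmoothFunction (Phase d))) fun θ =>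
    ⟨mulZak E θ, (mulZak E θ).continuous, fun f p => mulZak_apply E θ f p⟩) _

/-! ### The transposed Zak transform -/

/-- The decay of the partial Fourier transform in its frequency `m` beats the polynomial growth of
the translations by `m`. -/
theorem exists_hasSum_partialFourier (E : Module.Basis (Fin d) ℝ (Space d)) :
    ∃ S : 𝓢(Phase d, ℂ) →L[ℂ] 𝓢(Space d, ℂ), ∀ Φ, HasSum (fun m : lattice E =>
      SchwartzMap.compSubConstCLM ℂ (m : Space d) (partialFourier (m : Space d) Φ)) (S Φ) :=
  ((temperatelyGrowing_compSubConst.reindex fun j : lattice E => (j : Space d)).comp_rapid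
    (rapidlyDecreasing_partialFourier.reindex
      fun j : lattice E => (j : Space d)) fun j => by
        simp only [Function.comp_apply]; positivity).exists_sum (isSummableWeight_lattice E)

/-- The operator that maps `Φ` to `∑ ∫ e^{i⟪m, ξ⟫} Φ(x - m, ξ) dξ`. -/
def zakAverage (E : Module.Basis (Fin d) ℝ (Space d)) : 𝓢(Phase d, ℂ) →L[ℂ] 𝓢(Space d, ℂ) :=
  (exists_hasSum_partialFourier E).choose

theorem hasSum_zakAverage (E : Module.Basis (Fin d) ℝ (Space d)) (Φ : 𝓢(Phase d, ℂ)) :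
    HasSum (fun m : lattice E =>
      SchwartzMap.compSubConstCLM ℂ (m : Space d) (partialFourier (m : Space d) Φ))
      (zakAverage E Φ) := (exists_hasSum_partialFourier E).choose_spec Φ

theorem hasSum_zakAverage_apply (E : Module.Basis (Fin d) ℝ (Space d)) (Φ : 𝓢(Phase d, ℂ))
    (x : Space d) : HasSum (fun m : lattice E => ∫ ξ, character m ξ * Φ (x - m, ξ))
      (zakAverage E Φ x) := hasSum_apply (hasSum_zakAverage E Φ) x

/-- The function `(x, ξ) ↦ χ(x) ψ(ξ)`. -/
def tensor (χ ψ : 𝓢(Space d, ℂ)) (hχ : HasCompactSupport χ) (hψ : HasCompactSupport ψ) :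
    𝓢(Phase d, ℂ) :=
  HasCompactSupport.toSchwartzMap (f := fun p : Phase d => χ p.1 * ψ p.2)
    (HasCompactSupport.intro (hχ.prod hψ) fun p hp => by
      by_cases h : p.1 ∈ tsupport χ
      · rw [image_eq_zero_of_notMem_tsupport (f := ψ) fun h' => hp ⟨h, h'⟩, mul_zero]
      · rw [image_eq_zero_of_notMem_tsupport h, zero_mul])
    (((χ.smooth ⊤).comp contDiff_fst).mul ((ψ.smooth ⊤).comp contDiff_snd))

theorem hasCompactSupport_tensor (χ ψ : 𝓢(Space d, ℂ)) (hχ : HasCompactSupport χ)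
    (hψ : HasCompactSupport ψ) : HasCompactSupport (tensor χ ψ hχ hψ) :=
  HasCompactSupport.intro (hχ.prod hψ) fun p hp => by
    change χ p.1 * ψ p.2 = 0
    by_cases h : p.1 ∈ tsupport χ
    · rw [image_eq_zero_of_notMem_tsupport (f := ψ) fun h' => hp ⟨h, h'⟩, mul_zero]
    · rw [image_eq_zero_of_notMem_tsupport h, zero_mul]

@[simp]
theorem tensor_apply (χ ψ : 𝓢(Space d, ℂ)) (hχ : HasCompactSupport χ) (hψ : HasCompactSupport ψ)
    (p : Phase d) : tensor χ ψ hχ hψ p = χ p.1 * ψ p.2 := rfl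

section Inverse

variable {E : Module.Basis (Fin d) ℝ (Space d)} {χ ψ : 𝓢(Space d, ℂ)}

theorem IsQuasiPeriodic.character_mul {F : Phase d → ℂ} (hF : IsQuasiPeriodic E F) {m : Space d}
    (hm : m ∈ lattice E) (x ξ : Space d) : character m ξ * F (x - m, ξ) = F (x, ξ) := by
  rw [← hF.1 m hm, sub_add_cancel]

/-- Quasi-periodicity turns `e^{i⟪m, ξ⟫} F(x - m, ξ)` into `F(x, ξ)`, so the sum over `m` acts on
`χ` alone and gives one. This is why the integral on the right is a Schwartz function of `x`. -/
theorem zakAverage_of_isQuasiPeriodic (hχ : IsPartition E χ) {F : Phase d → ℂ}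
    (hF : IsQuasiPeriodic E F) {Φ : 𝓢(Phase d, ℂ)}
    (hΦ : ∀ x ξ, Φ (x, ξ) = χ x * (ψ ξ * F (x, ξ))) (x : Space d) :
    zakAverage E Φ x = ∫ ξ, ψ ξ * F (x, ξ) := by
  refine (hasSum_zakAverage_apply E Φ x).unique ?_
  have h1 := (hχ.hasSum x).mul_right (∫ ξ, ψ ξ * F (x, ξ))
  rw [one_mul] at h1
  refine h1.congr_fun fun m => ?_
  rw [← integral_const_mul]
  congr 1
  ext ξ
  rw [hΦ, ← hF.character_mul m.2 x ξ]
  ring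

end Inverse

end

section

variable {d : ℕ} {E : Module.Basis (Fin d) ℝ (Space d)} {χ ψ : 𝓢(Space d, ℂ)}

/-! ### The inverse of the Zak transform -/

theorem integral_partition_mul_zak (hψ : IsPartition (dual E) ψ) (f : 𝓢(Space d, ℂ))
    (x : Space d) : (∫ ξ, ψ ξ)⁻¹ * ∫ ξ, ψ ξ * zak E f (x, ξ) = f x := by
  have h1 : ∀ j : lattice E, (fun ξ => ψ ξ * zakTerm f x ξ j) =
      fun ξ => f (x - j) * (character j ξ * ψ ξ) := fun j => by
    ext ξ
    rw [zakTerm]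
    ring
  have h2 : HasSum (fun j : lattice E => ∫ ξ, ψ ξ * zakTerm f x ξ j)
      (∫ ξ, ∑' j : lattice E, ψ ξ * zakTerm f x ξ j) := by
    refine hasSum_integral_of_summable_integral_norm (fun j => ?_) ?_
    · rw [h1]
      exact (integrable_character_mul _ ψ).const_mul _
    · simp only [zakTerm, norm_mul, norm_character, mul_one, integral_mul_const]
      -- The norms of the terms do not depend on `ξ`, so summability at `ξ = 0` suffices.
      have := (hasSum_zak E f (x, 0)).summable.norm
      simp only [zakTerm, norm_mul, norm_character, mul_one] at this
      exact this.mul_left _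
  simp only [tsum_mul_left] at h2
  have h3 : HasSum (fun j : lattice E => ∫ ξ, ψ ξ * zakTerm f x ξ j) (f x * ∫ ξ, ψ ξ) := by
    convert hasSum_ite_eq (0 : lattice E) (f x * ∫ ξ, ψ ξ) using 1
    funext j
    rw [h1, integral_const_mul]
    split_ifs with hj
    · simp [hj]
    · rw [integral_character_mul_partition E hψ j.2 fun h => hj (Subtype.ext h), mul_zero]
  have h4 := h2.unique h3
  change _ * (∫ ξ, ψ ξ * ∑' j : lattice E, zakTerm f x ξ j) = _
  rw [h4, mul_comm, mul_assoc, mul_inv_cancel₀ hψ.integral_ne_zero, mul_one]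

theorem zak_inverse_apply (hχ : IsPartition E χ) (hψ : IsPartition (dual E) ψ)
    {F : Phase d → ℂ} (hF : IsQuasiPeriodic E F) {Φ : 𝓢(Phase d, ℂ)}
    (hΦ : ∀ p, Φ p = tensor χ ψ hχ.hasCompactSupport hψ.hasCompactSupport p * F p) (x : Space d) :
    ((∫ ξ, ψ ξ)⁻¹ • zakAverage E Φ) x = (∫ ξ, ψ ξ)⁻¹ * ∫ ξ, ψ ξ * F (x, ξ) := by
  rw [smul_apply, smul_eq_mul, zakAverage_of_isQuasiPeriodic hχ hF fun x ξ => ?_]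
  rw [hΦ, tensor_apply]
  ring

theorem zakAverage_mulZak (hχ : IsPartition E χ) (hψ : IsPartition (dual E) ψ)
    (f : 𝓢(Space d, ℂ)) : (∫ ξ, ψ ξ)⁻¹ • zakAverage E
      (mulZak E (tensor χ ψ hχ.hasCompactSupport hψ.hasCompactSupport) f) = f := by
  ext x
  rw [zak_inverse_apply hχ hψ (isQuasiPeriodic_zak E f) fun p => mulZak_apply E _ f p,
    integral_partition_mul_zak hψ]

/-- The values at `x - j` are the Fourier coefficients of `ψ F(x, ·)`. Poisson summation returns its
periodization, which is `F(x, ·)` since `F` is periodic in `ξ` and the translates of `ψ` sum to one.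
-/
theorem zak_zakAverage_of_isQuasiPeriodic (hχ : IsPartition E χ) (hψ : IsPartition (dual E) ψ)
    {F : Phase d → ℂ} (hc : ContDiff ℝ ∞ F) (hF : IsQuasiPeriodic E F) {Φ : 𝓢(Phase d, ℂ)}
    (hΦ : ∀ p, Φ p = tensor χ ψ hχ.hasCompactSupport hψ.hasCompactSupport p * F p) :
    zak E ((∫ ξ, ψ ξ)⁻¹ • zakAverage E Φ : 𝓢(Space d, ℂ)) = F := by
  funext ⟨x, ξ⟩
  let g : 𝓢(Space d, ℂ) := mulSmooth ψ hψ.hasCompactSupport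
    ⟨fun ξ => F (x, ξ), hc.comp (contDiff_const.prodMk contDiff_id)⟩
  have hg : ∀ ξ, g ξ = ψ ξ * F (x, ξ) := fun ξ => rfl
  have h1 : zak E ((∫ ξ, ψ ξ)⁻¹ • zakAverage E Φ : 𝓢(Space d, ℂ)) (x, ξ) =
      fourierSeries E ψ g ξ := by
    refine tsum_congr fun j => ?_
    rw [zakTerm, zak_inverse_apply hχ hψ hF hΦ, fourierCoeff]
    congr 3
    ext ξ
    rw [hg, ← hF.character_mul j.2 x ξ, mul_left_comm, ← mul_assoc (character _ _),
      character_neg_mul, one_mul]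
  rw [h1, fourierSeries_eq_periodization E hψ]
  refine (hasSum_periodization _ g ξ).unique ?_
  have h2 := (hψ.hasSum ξ).mul_right (F (x, ξ))
  rw [one_mul] at h2
  refine h2.congr_fun fun k => ?_
  rw [hg]
  congr 1
  rw [sub_eq_add_neg]
  exact hF.2 _ (by rw [dualLattice_eq]; exact neg_mem k.2) x ξ

/-- The Zak transform is a homeomorphism onto the quasi-periodic smooth functions. -/
def zakHomeomorph (hχ : IsPartition E χ) (hψ : IsPartition (dual E) ψ) :
    𝓢(Space d, ℂ) ≃ₜ QuasiPeriodicSmooth E where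
  toFun := zakSmooth E
  invFun F := (∫ ξ, ψ ξ)⁻¹ • zakAverage E
    (mulSmooth (tensor χ ψ hχ.hasCompactSupport hψ.hasCompactSupport)
      (hasCompactSupport_tensor ..) F.1)
  left_inv f := by
    ext x
    rw [zak_inverse_apply hχ hψ (isQuasiPeriodic_zak E f) fun p => mulSmooth_apply ..]
    exact integral_partition_mul_zak hψ f x
  right_inv F := Subtype.ext <| SmoothFunction.ext <|
    zak_zakAverage_of_isQuasiPeriodic hχ hψ F.1.contDiff F.2 fun p => mulSmooth_apply ..
  continuous_toFun := continuous_zakSmooth E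
  continuous_invFun := (continuous_const_smul _).comp ((zakAverage E).continuous.comp
    ((continuous_mulSmooth _ _).comp continuous_subtype_val))

end

/-! ### Summable weights on products of lattices -/

section

theorem IsSummableWeight.prod {ι κ : Type*} {s : ι → ℝ} {t : κ → ℝ} (hs : IsSummableWeight s)
    (ht : IsSummableWeight t) {w : ι × κ → ℝ} (hw : ∀ p, 1 ≤ w p)
    (h : ∀ p, s p.1 * t p.2 ≤ w p ^ 2) : IsSummableWeight w := by
  obtain ⟨N, hN⟩ := hs.summable
  obtain ⟨M, hM⟩ := ht.summable
  have hs0 : ∀ i, 0 < s i := fun i => zero_lt_one.trans_le (hs.one_le i)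
  have ht0 : ∀ i, 0 < t i := fun i => zero_lt_one.trans_le (ht.one_le i)
  refine ⟨hw, 2 * (N + M), Summable.of_nonneg_of_le
    (fun p => inv_nonneg.2 (pow_nonneg (zero_le_one.trans (hw p)) _)) (fun p => ?_)
    (hN.mul_of_nonneg hM (fun i => inv_nonneg.2 (pow_nonneg (hs0 i).le _))
      fun i => inv_nonneg.2 (pow_nonneg (ht0 i).le _))⟩
  rw [← mul_inv]
  refine inv_anti₀ (mul_pos (pow_pos (hs0 _) _) (pow_pos (ht0 _) _)) ?_
  calc s p.1 ^ N * t p.2 ^ M ≤ s p.1 ^ (N + M) * t p.2 ^ (N + M) :=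
        mul_le_mul (pow_le_pow_right₀ (hs.one_le _) (Nat.le_add_right _ _))
          (pow_le_pow_right₀ (ht.one_le _) (Nat.le_add_left _ _)) (pow_pos (ht0 _) _).le
          (pow_pos (hs0 _) _).le
    _ ≤ w p ^ (2 * (N + M)) := by
        rw [← mul_pow, pow_mul]
        exact pow_le_pow_left₀ (mul_pos (hs0 _) (ht0 _)).le (h p) _

variable {d : ℕ}

theorem isSummableWeight_lattice_prod (b b' : Module.Basis (Fin d) ℝ (Space d)) :
    IsSummableWeight fun p : lattice b' × lattice b =>
      1 + ‖(((p.2 : Space d), (p.1 : Space d)) : Phase d)‖ := by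
  refine (isSummableWeight_lattice b').prod (isSummableWeight_lattice b)
    (fun p => le_add_of_nonneg_right (norm_nonneg _)) fun p => ?_
  rw [sq]
  gcongr
  · exact norm_snd_le ((p.2 : Space d), (p.1 : Space d))
  · exact norm_fst_le ((p.2 : Space d), (p.1 : Space d))

/-! ### The transpose and its right inverse -/

/-- The operator that maps `Φ` to `(x, ξ) ↦ Φ(x, -ξ)`. -/
def reflect : 𝓢(Phase d, ℂ) →L[ℂ] 𝓢(Phase d, ℂ) :=
  SchwartzMap.compCLMOfContinuousLinearEquiv ℂ
    ((ContinuousLinearEquiv.refl ℝ (Space d)).prodCongr (ContinuousLinearEquiv.neg ℝ))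

@[simp]
theorem reflect_apply (Φ : 𝓢(Phase d, ℂ)) (p : Phase d) : reflect Φ p = Φ (p.1, -p.2) := rfl

@[simp]
theorem reflect_reflect (Φ : 𝓢(Phase d, ℂ)) : reflect (reflect Φ) = Φ := by
  ext p
  simp

/-- The transpose of the Zak transform. -/
def transposeZak (E : Module.Basis (Fin d) ℝ (Space d)) : 𝓢(Phase d, ℂ) →L[ℂ] 𝓢(Space d, ℂ) :=
  (zakAverage E).comp reflect

theorem hasSum_transposeZak_apply (E : Module.Basis (Fin d) ℝ (Space d)) (Φ : 𝓢(Phase d, ℂ))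
    (x : Space d) : HasSum (fun m : lattice E => ∫ ξ, character m ξ * Φ (x - m, -ξ))
      (transposeZak E Φ x) := hasSum_zakAverage_apply E (reflect Φ) x

theorem transposeZak_translate_fst (E : Module.Basis (Fin d) ℝ (Space d)) {k : Space d}
    (hk : k ∈ lattice E) (Φ : 𝓢(Phase d, ℂ)) :
    transposeZak E (SchwartzMap.compSubConstCLM ℂ ((k, 0) : Phase d) Φ) =
      transposeZak E (modulate k Φ) := by
  ext x
  have h1 := hasSum_transposeZak_apply E
    (SchwartzMap.compSubConstCLM ℂ ((k, 0) : Phase d) Φ) x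
  have h2 := hasSum_transposeZak_apply E (modulate k Φ) x
  rw [← (Equiv.addRight (⟨k, hk⟩ : lattice E)).hasSum_iff] at h2
  refine h1.unique (h2.congr_fun fun m => ?_)
  simp only [Function.comp_apply, Equiv.coe_addRight, Submodule.coe_add, modulate_apply,
    SchwartzMap.compSubConstCLM_apply, Prod.mk_sub_mk, sub_zero]
  congr 1
  ext ξ
  rw [character_add_left, ← character_neg_left, ← mul_assoc, mul_assoc (character _ _),
    mul_comm (character k ξ), character_neg_mul, mul_one, sub_sub]

theorem transposeZak_translate_snd (E : Module.Basis (Fin d) ℝ (Space d)) {κ : Space d}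
    (hκ : κ ∈ dualLattice E) (Φ : 𝓢(Phase d, ℂ)) :
    transposeZak E (SchwartzMap.compSubConstCLM ℂ ((0, κ) : Phase d) Φ) = transposeZak E Φ := by
  ext x
  have h1 := hasSum_transposeZak_apply E
    (SchwartzMap.compSubConstCLM ℂ ((0, κ) : Phase d) Φ) x
  refine h1.unique ((hasSum_transposeZak_apply E Φ x).congr_fun fun m => ?_)
  rw [← integral_sub_right_eq_self _ κ]
  congr 1
  ext ξ
  rw [dualLattice_eq] at hκ
  rw [sub_eq_add_neg ξ, character_add_right, character_eq_one E m.2 (neg_mem hκ)]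
  simp

variable {E : Module.Basis (Fin d) ℝ (Space d)} {χ ψ : 𝓢(Space d, ℂ)}

/-- A right inverse of the transpose of the Zak transform. -/
def transposeLift (hχ : IsPartition E χ) (hψ : IsPartition (dual E) ψ) :
    𝓢(Space d, ℂ) →L[ℂ] 𝓢(Phase d, ℂ) :=
  reflect.comp ((∫ ξ, ψ ξ)⁻¹ •
    mulZak E (tensor χ ψ hχ.hasCompactSupport hψ.hasCompactSupport))

theorem transposeZak_transposeLift (hχ : IsPartition E χ) (hψ : IsPartition (dual E) ψ)
    (f : 𝓢(Space d, ℂ)) : transposeZak E (transposeLift hχ hψ f) = f := by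
  conv_rhs => rw [← zakAverage_mulZak hχ hψ f]
  change zakAverage E (reflect (reflect _)) = _
  rw [reflect_reflect]
  exact (zakAverage E).map_smul _ _

/-! ### Quasi-periodization of Schwartz functions -/

theorem temperatelyGrowing_charMul :
    TemperatelyGrowing (fun k : Space d => 1 + ‖k‖) (charMul : Space d → _) := by
  refine (temperatelyGrowing_expMul.reindex fun k : Space d => innerSL ℝ k).mono
    (fun k => by simp only [Function.comp_apply]; positivity) zero_le_one fun k => ?_
  simp

/-- Performs the sum over the lattice in `x` alone. The Fourier integrals of the result at `-j` are
the values of `zakAverage E Ψ` at `x - j`, which prepares Poisson summation in `ξ`. -/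
theorem exists_sum_character_mul_slice (E : Module.Basis (Fin d) ℝ (Space d))
    (Ψ : 𝓢(Phase d, ℂ)) (x : Space d) : ∃ h : 𝓢(Space d, ℂ),
      (∀ ξ, HasSum (fun m : lattice E => character m ξ * Ψ (x - m, ξ)) (h ξ)) ∧
      ∀ j : Space d, HasSum (fun m : lattice E => ∫ ξ, character (-j) ξ *
        (character m ξ * Ψ (x - m, ξ))) (∫ ξ, character (-j) ξ * h ξ) := by
  have hr : RapidlyDecreasing (fun m : lattice E => 1 + ‖(m : Space d)‖)
      fun m : lattice E => (slice (-(m : Space d)) : 𝓢(Phase d, ℂ) →L[ℂ] 𝓢(Space d, ℂ)) := by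
    have := (rapidlyDecreasing_slice (V := Space d) (W := Space d) (F := ℂ)).reindex
      fun m : lattice E => -(m : Space d)
    simpa [Function.comp_def] using this
  obtain ⟨S, hS⟩ := ((temperatelyGrowing_charMul.reindex fun m : lattice E =>
    (m : Space d)).comp_rapid hr fun m => by
      simp only [Function.comp_apply]; positivity).exists_sum (isSummableWeight_lattice E)
  have hS' := hS (SchwartzMap.compSubConstCLM ℂ ((-x, 0) : Phase d) Ψ)
  have e : ∀ (m : lattice E) ξ, (charMul (m : Space d)).comp (slice (-(m : Space d)))
      (SchwartzMap.compSubConstCLM ℂ ((-x, 0) : Phase d) Ψ) ξ =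
      character m ξ * Ψ (x - m, ξ) := fun m ξ => by
    simp [neg_add_eq_sub]
  refine ⟨_, fun ξ => (hasSum_apply hS' ξ).congr_fun fun m => (e m ξ).symm, fun j => ?_⟩
  have h1 := (hS'.mapL (charMul (-j))).mapL (SchwartzMap.integralCLM ℂ volume)
  simp only [SchwartzMap.integralCLM_apply, charMul_apply, e] at h1
  exact h1

/-- Poisson summation in `ξ` identifies `Z` of the average with the quasi-periodization of `Ψ`.
Convergence of the double series is a hypothesis, with a factor `c`, because it is obtained later
from the cutoff `c = θ(x, ξ)`. -/
theorem zak_zakAverage (hψ : IsPartition (dual E) ψ) (Ψ : 𝓢(Phase d, ℂ)) (x ξ : Space d) (c s : ℂ)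
    (hs : HasSum (fun p : lattice (dual E) × lattice E =>
      c * (character p.2 ξ * Ψ (x - p.2, ξ - p.1))) s) :
    s = c * ((∫ ξ, ψ ξ)⁻¹ * zak E (zakAverage E Ψ) (x, ξ)) := by
  obtain ⟨h, hh, hi⟩ := exists_sum_character_mul_slice E Ψ x
  have h1 : (∫ ξ, ψ ξ)⁻¹ * zak E (zakAverage E Ψ) (x, ξ) = fourierSeries E ψ h ξ := by
    rw [zak, ← tsum_mul_left]
    refine tsum_congr fun j => ?_
    rw [zakTerm, fourierCoeff, mul_assoc]
    congr 2
    have h2 := hi j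
    rw [← (Equiv.addRight j).hasSum_iff] at h2
    refine (hasSum_zakAverage_apply E Ψ (x - j)).unique (h2.congr_fun fun m => ?_)
    simp only [Function.comp_apply, Equiv.coe_addRight, Submodule.coe_add]
    congr 1
    ext η
    rw [character_add_left, sub_sub, add_comm (j : Space d)]
    linear_combination (-(character (m : Space d) η * Ψ (x - (m + j), η))) *
      character_neg_mul (j : Space d) η
  rw [h1, fourierSeries_eq_periodization E hψ]
  have h3 : ∀ κ : lattice (dual E), HasSum (fun m : lattice E =>
      c * (character m ξ * Ψ (x - m, ξ - κ))) (c * h (ξ - κ)) := fun κ => by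
    refine ((hh (ξ - κ)).mul_left c).congr_fun fun m => ?_
    rw [sub_eq_add_neg ξ, character_add_right, character_eq_one E m.2 (neg_mem κ.2), mul_one]
  exact (hs.prod_fiberwise h3).unique ((hasSum_periodization _ h ξ).mul_left c)

/-- Up to reflections the sum is the lift of the transpose. Convergence in the Schwartz space allows
a continuous functional to be applied term by term. -/
theorem hasSum_quasiPeriodization (hχ : IsPartition E χ) (hψ : IsPartition (dual E) ψ)
    (Ψ : 𝓢(Phase d, ℂ)) :
    HasSum (fun p : lattice (dual E) × lattice E => modulate p.2
      (mulComp (tensor χ ψ hχ.hasCompactSupport hψ.hasCompactSupport)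
        (ContinuousLinearMap.id ℝ (Phase d)) (p.2, p.1) Ψ))
      ((∫ ξ, ψ ξ)⁻¹ • mulZak E (tensor χ ψ hχ.hasCompactSupport hψ.hasCompactSupport)
        (zakAverage E Ψ)) := by
  set θ := tensor χ ψ hχ.hasCompactSupport hψ.hasCompactSupport
  let φ : lattice (dual E) × lattice E → Phase d := fun p => (p.2, p.1)
  have hm : TemperatelyGrowing (fun p => 1 + ‖φ p‖)
      fun p : lattice (dual E) × lattice E => modulate (p.2 : Space d) :=
    (temperatelyGrowing_modulate.reindex fun p : lattice (dual E) × lattice E =>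
      (p.2 : Space d)).mono (fun p => by simp only [Function.comp_apply]; positivity)
      zero_le_one fun p => by
        rw [one_mul]
        exact add_le_add_right (norm_fst_le (φ p)) 1
  obtain ⟨S, hS⟩ := (hm.comp_rapid ((rapidlyDecreasing_mulComp θ
    (ContinuousLinearMap.id ℝ (Phase d))).reindex φ) fun p => by positivity).exists_sum
      (isSummableWeight_lattice_prod E (dual E))
  have h1 : S Ψ = (∫ ξ, ψ ξ)⁻¹ • mulZak E θ (zakAverage E Ψ) := by
    ext ⟨x, ξ⟩
    rw [zak_zakAverage hψ Ψ x ξ (θ (x, ξ)) (S Ψ (x, ξ))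
      ((hasSum_apply (hS Ψ) (x, ξ)).congr_fun fun p => ?_), smul_apply, mulZak_apply,
      smul_eq_mul, mul_left_comm]
    simp [φ, modulate_apply, mul_left_comm]
  rw [← h1]
  exact hS Ψ

theorem hasSum_mul_translates_tensor (hχ : IsPartition E χ) (hψ : IsPartition (dual E) ψ)
    (Ψ : 𝓢(Phase d, ℂ)) :
    HasSum (fun p : lattice (dual E) × lattice E => mulComp Ψ
      (ContinuousLinearMap.id ℝ (Phase d)) (-((p.2 : Space d), (p.1 : Space d)))
      (tensor χ ψ hχ.hasCompactSupport hψ.hasCompactSupport)) Ψ := by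
  set θ := tensor χ ψ hχ.hasCompactSupport hψ.hasCompactSupport
  let φ : lattice (dual E) × lattice E → Phase d := fun p => -((p.2 : Space d), (p.1 : Space d))
  have hr := (rapidlyDecreasing_mulComp Ψ (ContinuousLinearMap.id ℝ (Phase d))).reindex φ
  have hw : (fun v : Phase d => 1 + ‖v‖) ∘ φ = fun p : lattice (dual E) × lattice E =>
      1 + ‖(((p.2 : Space d), (p.1 : Space d)) : Phase d)‖ := funext fun p => by
    simp only [Function.comp_apply, φ, norm_neg]
  rw [hw] at hr
  obtain ⟨S, hS⟩ := hr.exists_sum (isSummableWeight_lattice_prod E (dual E))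
  have h1 : S θ = Ψ := by
    -- Pointwise, the product of the two partitions of unity sums to one; the signs come from
    -- indexing the translates by negatives.
    ext ⟨x, ξ⟩
    refine (hasSum_apply (hS θ) (x, ξ)).unique ?_
    have h2 := (Equiv.neg (lattice E)).hasSum_iff.2 (hχ.hasSum x)
    have h3 := (Equiv.neg (lattice (dual E))).hasSum_iff.2 (hψ.hasSum ξ)
    have h4 := (h3.mul h2 (summable_mul_of_summable_norm h3.summable.norm
      h2.summable.norm)).mul_left (Ψ (x, ξ))
    rw [mul_one, mul_one] at h4
    refine h4.congr_fun fun p => ?_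
    simp [θ, φ, mul_comm]
  rw [← h1]
  exact h1 ▸ hS θ

theorem transposeLift_transposeZak (hχ : IsPartition E χ) (hψ : IsPartition (dual E) ψ)
    (u : 𝓢(Phase d, ℂ) →L[ℂ] ℂ) (hu : IsQuasiPeriodicFunctional E u) (Φ : 𝓢(Phase d, ℂ)) :
    u (transposeLift hχ hψ (transposeZak E Φ)) = u Φ := by
  have h1 := (hasSum_quasiPeriodization hχ hψ (reflect Φ)).mapL (u.comp reflect)
  have h2 := (hasSum_mul_translates_tensor hχ hψ (reflect Φ)).mapL (u.comp reflect)
  have h3 : u.comp reflect (reflect Φ) = u Φ := congrArg u (reflect_reflect Φ)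
  rw [h3] at h2
  refine h1.unique (h2.congr_fun fun p => ?_)
  obtain ⟨κ, m⟩ := p
  set θ := tensor χ ψ hχ.hasCompactSupport hψ.hasCompactSupport
  set Θ := mulComp θ (ContinuousLinearMap.id ℝ (Phase d)) (m, κ) (reflect Φ)
  change u (reflect (modulate m Θ)) = u (reflect _)
  have e1 : reflect (modulate m Θ) = modulate (-(m : Space d)) (reflect Θ) := by
    ext ⟨x, ξ⟩
    simp [modulate_apply, character_neg_left]
  -- The terms of the two series differ by a translation along each lattice and a modulation, which
  -- `u` cannot distinguish: the shift passes from `Φ` to `θ`.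
  have e2 : reflect (mulComp (reflect Φ) (ContinuousLinearMap.id ℝ (Phase d))
      (-((m : Space d), (κ : Space d))) θ) =
      SchwartzMap.compSubConstCLM ℂ ((0, (κ : Space d)) : Phase d)
        (SchwartzMap.compSubConstCLM ℂ ((-(m : Space d), 0) : Phase d) (reflect Θ)) := by
    ext ⟨x, ξ⟩
    simp [Θ, mul_comm, neg_add_eq_sub]
  rw [e1, e2, ← hu.1 _ (neg_mem m.2), hu.2 _ (by rw [dualLattice_eq]; exact κ.2)]

theorem isQuasiPeriodicFunctional_comp_transposeZak (E : Module.Basis (Fin d) ℝ (Space d))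
    (u : 𝓢(Space d, ℂ) → ℂ) : IsQuasiPeriodicFunctional E fun Φ => u (transposeZak E Φ) :=
  ⟨fun _ hk Φ => congrArg u (transposeZak_translate_fst E hk Φ),
    fun _ hκ Φ => congrArg u (transposeZak_translate_snd E hκ Φ)⟩

/-! ### Compatibility with the Zak transform of functions -/

instance isAddHaarMeasure_phase : (volume : Measure (Phase d)).IsAddHaarMeasure :=
  inferInstanceAs ((volume : Measure (Space d)).prod volume).IsAddHaarMeasure

/-- Fubini, term by term: the term `j` of `Z f` pairs with the term `-j` of the average after a
shift of `x` by `j` and the change of sign of `ξ` that undoes `reflect`. -/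
theorem isGivenBy_comp_transposeZak (E : Module.Basis (Fin d) ℝ (Space d)) (f : 𝓢(Space d, ℂ))
    (u : 𝓢(Space d, ℂ) →L[ℂ] ℂ) (hu : IsGivenBy u f) :
    IsGivenBy (fun Φ => u (transposeZak E Φ)) (zak E f) := by
  intro Φ
  have hz : ∀ p, mulZak E Φ f p = zak E f p * Φ p := fun p => by
    rw [mulZak_apply, mul_comm]
  have hi : Integrable fun p => zak E f p * Φ p :=
    ((mulZak E Φ f).integrable (μ := volume)).congr (Filter.Eventually.of_forall hz)
  refine ⟨hi, ?_⟩
  have h1 := (hasSum_mulZak E Φ f).mapL (SchwartzMap.integralCLM ℂ (volume : Measure (Phase d)))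
  simp only [SchwartzMap.integralCLM_apply, hz] at h1
  have h2 := (hasSum_zakAverage E (reflect Φ)).mapL u
  rw [← (Equiv.neg (lattice E)).hasSum_iff] at h2
  refine h2.unique (h1.congr_fun fun j => ?_)
  set G := modulate (j : Space d) (mulComp Φ (ContinuousLinearMap.fst ℝ (Space d) (Space d)) j f)
  have hG : Integrable G := G.integrable
  rw [Function.comp_apply, (hu _).2, Measure.volume_eq_prod, integral_prod _ hG,
    ← integral_sub_right_eq_self _ (j : Space d)]
  congr 1
  ext x
  simp only [Equiv.neg_apply, Submodule.coe_neg, SchwartzMap.compSubConstCLM_apply,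
    partialFourier_apply, reflect_apply]
  rw [← integral_const_mul, ← integral_neg_eq_self]
  congr 1
  ext ξ
  simp only [G, modulate_mulComp_apply, zakTerm, character_neg_left, neg_neg, sub_neg_eq_add,
    sub_add_cancel]
  ring

end

section

/-! ### Rapidly decreasing families with two indices -/

section TwoIndices

variable {ι κ U V W F G H : Type*} [NormedAddCommGroup U] [NormedSpace ℝ U] [NormedAddCommGroup V]
  [NormedSpace ℝ V] [NormedAddCommGroup W] [NormedSpace ℝ W] [NormedAddCommGroup F]
  [NormedSpace ℝ F] [NormedSpace ℂ F] [NormedAddCommGroup G] [NormedSpace ℝ G] [NormedSpace ℂ G]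
  [NormedAddCommGroup H] [NormedSpace ℝ H] [NormedSpace ℂ H]
  [SMulCommClass ℝ ℂ F] [SMulCommClass ℝ ℂ G] [SMulCommClass ℝ ℂ H]

theorem RapidlyDecreasing.comp_prod {s : ι → ℝ} {t : κ → ℝ} {B : κ → 𝓢(V, G) →L[ℂ] 𝓢(W, H)}
    {A : ι → 𝓢(U, F) →L[ℂ] 𝓢(V, G)} (hB : RapidlyDecreasing t B) (hA : RapidlyDecreasing s A)
    (hs : ∀ i, 0 ≤ s i) :
    RapidlyDecreasing (fun p : ι × κ => s p.1 * t p.2) fun p => (B p.2).comp (A p.1) := by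
  intro N k n
  obtain ⟨J, C, hC, hB⟩ := hB N k n
  obtain ⟨I, D, hD, hA⟩ := hA.sup hs N J
  refine ⟨I, C * D, mul_nonneg hC hD, fun p f => ?_⟩
  calc (s p.1 * t p.2) ^ N * SchwartzMap.seminorm ℂ k n (B p.2 (A p.1 f))
      = s p.1 ^ N * (t p.2 ^ N * SchwartzMap.seminorm ℂ k n (B p.2 (A p.1 f))) := by ring
    _ ≤ s p.1 ^ N * (C * J.sup (schwartzSeminormFamily ℂ V G) (A p.1 f)) :=
        mul_le_mul_of_nonneg_left (hB _ _) (pow_nonneg (hs _) _)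
    _ = C * (s p.1 ^ N * J.sup (schwartzSeminormFamily ℂ V G) (A p.1 f)) := by ring
    _ ≤ C * (D * I.sup (schwartzSeminormFamily ℂ U F) f) :=
        mul_le_mul_of_nonneg_left (hA _ _) hC
    _ = C * D * I.sup (schwartzSeminormFamily ℂ U F) f := by ring

end TwoIndices

variable {d : ℕ}

/-! ### Lattices with long dual vectors -/

/-- Some basis vector has a nonzero inner product with `κ`, which is a multiple of `2π`; the bound
is Cauchy–Schwarz. -/
theorem le_norm_of_mem_lattice_dual (E : Module.Basis (Fin d) ℝ (Space d)) {ε : ℝ} (hε : 0 < ε)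
    (hE : ∀ i, ‖E i‖ ≤ ε) {κ : Space d} (hκ : κ ∈ lattice (dual E)) (h0 : κ ≠ 0) :
    2 * Real.pi / ε ≤ ‖κ‖ := by
  obtain ⟨i, hi⟩ : ∃ i, inner ℝ (E i) κ ≠ 0 := by
    by_contra! h
    exact h0 (InnerProductSpace.ext_inner_left_basis E fun i => by rw [h, inner_zero_right])
  obtain ⟨n, hn⟩ := exists_inner_eq E (Submodule.subset_span ⟨i, rfl⟩ : E i ∈ lattice E) hκ
  rw [hn] at hi
  have hn0 : (1 : ℝ) ≤ |(n : ℝ)| := by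
    have : n ≠ 0 := fun h => hi (by simp [h])
    exact_mod_cast Int.one_le_abs this
  have h1 := abs_real_inner_le_norm (E i) κ
  rw [hn, abs_mul, abs_of_pos (by positivity : 0 < 2 * Real.pi)] at h1
  rw [div_le_iff₀' hε]
  calc 2 * Real.pi ≤ |(n : ℝ)| * (2 * Real.pi) := le_mul_of_one_le_left (by positivity) hn0
    _ ≤ ‖E i‖ * ‖κ‖ := h1
    _ ≤ ε * ‖κ‖ := by gcongr; exact hE i

theorem exists_basis_dual_norm_gt (d : ℕ) (R : ℝ) : ∃ E : Module.Basis (Fin d) ℝ (Space d),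
    ∀ κ ∈ lattice (dual E), κ ≠ 0 → R < ‖κ‖ := by
  set ε := Real.pi / (|R| + 1)
  have hε : 0 < ε := by positivity
  let E := (EuclideanSpace.basisFun (Fin d) ℝ).toBasis.isUnitSMul (w := fun _ => ε)
    fun _ => hε.ne'.isUnit
  refine ⟨E, fun κ hκ h0 => lt_of_lt_of_le ?_
    (le_norm_of_mem_lattice_dual E hε (fun i => ?_) hκ h0)⟩
  · have : 2 * Real.pi / ε = 2 * (|R| + 1) := by
      simp only [ε]
      field_simp
    rw [this]
    linarith [le_abs_self R, abs_nonneg R]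
  · rw [Module.Basis.isUnitSMul_apply, norm_smul, Real.norm_of_nonneg hε.le]
    simp

theorem exists_schwartz_eq_one (R : ℝ) : ∃ χ : 𝓢(Space d, ℂ), HasCompactSupport χ ∧
    (∀ x, ‖x‖ ≤ R → χ x = 1) ∧ ∀ x, χ x ≠ 0 → ‖x‖ < |R| + 2 := by
  let β : ContDiffBump (0 : Space d) := ⟨|R| + 1, |R| + 2, by positivity, by linarith⟩
  have hs : HasCompactSupport fun v => (β v : ℂ) :=
    β.hasCompactSupport.comp_left (g := fun r : ℝ => (r : ℂ)) Complex.ofReal_zero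
  refine ⟨hs.toSchwartzMap (Complex.ofRealCLM.contDiff.comp β.contDiff), hs, fun x hx => ?_,
    fun x hx => ?_⟩
  · change ((β x : ℝ) : ℂ) = 1
    rw [β.one_of_mem_closedBall, Complex.ofReal_one]
    rw [mem_closedBall_zero_iff]
    change ‖x‖ ≤ |R| + 1
    linarith [le_abs_self R]
  · have h1 : β x ≠ 0 := fun h => hx (by change ((β x : ℝ) : ℂ) = 0; simp [h])
    have h2 : x ∈ Function.support β := h1
    rw [β.support_eq, mem_ball_zero_iff] at h2
    exact h2

/-! ### Approximation of the identity by operators of finite rank -/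

section Approximation

variable {b E : Module.Basis (Fin d) ℝ (Space d)} {χ σ ψ : 𝓢(Space d, ℂ)}

/-- An operator of rank one: up to translation by `m`, the term of index `j` of the Fourier series
of `χ f`, times `σ`. -/
def rankOne (ψ : 𝓢(Space d, ℂ)) (hσ : HasCompactSupport σ) (hχ : HasCompactSupport χ)
    (m j : Space d) : 𝓢(Space d, ℂ) →L[ℂ] 𝓢(Space d, ℂ) :=
  -- The innermost operator sends `f` to `σ(x) χ(ξ) f(ξ + m)`, and integration in `ξ` leaves `σ`
  -- times a Fourier coefficient. Written this way, decay in `m` comes from `mulComp` and decay in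
  -- `j` from `partialFourier`.
  (SchwartzMap.compSubConstCLM ℂ m).comp ((charMul j).comp
    (((∫ ξ, ψ ξ)⁻¹ • partialFourier (-j)).comp
      (mulComp (tensor σ χ hσ hχ) (ContinuousLinearMap.snd ℝ (Space d) (Space d)) (-m))))

theorem rankOne_apply (ψ : 𝓢(Space d, ℂ)) (hσ : HasCompactSupport σ) (hχ : HasCompactSupport χ)
    (m j : Space d) (f : 𝓢(Space d, ℂ)) (x : Space d) :
    rankOne ψ hσ hχ m j f x = σ (x - m) *
      (fourierCoeff ψ (mulComp χ (ContinuousLinearMap.id ℝ (Space d)) (-m) f) j *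
        character j (x - m)) := by
  have h1 : ∫ ξ, character (-j) ξ * (σ (x - m) * χ ξ * f (ξ + m)) =
      σ (x - m) * ∫ ξ, character (-j) ξ * (χ ξ * f (ξ + m)) := by
    rw [← integral_const_mul]
    congr 1
    ext ξ
    ring
  simp [rankOne, fourierCoeff, partialFourier_apply, h1]
  ring

theorem exists_eq_smul_rankOne (ψ : 𝓢(Space d, ℂ)) (hσ : HasCompactSupport σ)
    (hχ : HasCompactSupport χ) (m j : Space d) : ∃ a c : 𝓢(Space d, ℂ), ∀ f : 𝓢(Space d, ℂ),
      rankOne ψ hσ hχ m j f = (∫ ξ, a ξ * f ξ) • c := by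
  refine ⟨(∫ ξ, ψ ξ)⁻¹ • SchwartzMap.compSubConstCLM ℂ m (charMul (-j) χ),
    SchwartzMap.compSubConstCLM ℂ m (charMul j σ), fun f => ?_⟩
  ext x
  have h1 : ∫ ξ, ((∫ ξ, ψ ξ)⁻¹ • SchwartzMap.compSubConstCLM ℂ m (charMul (-j) χ)) ξ * f ξ =
      fourierCoeff ψ (mulComp χ (ContinuousLinearMap.id ℝ (Space d)) (-m) f) j := by
    rw [fourierCoeff, ← integral_const_mul, ← integral_add_right_eq_self _ m]
    congr 1
    ext ξ
    simp
    ring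
  rw [rankOne_apply, smul_apply, smul_eq_mul, h1]
  simp
  ring

theorem isSummableWeight_mul (b E : Module.Basis (Fin d) ℝ (Space d)) : IsSummableWeight
    fun p : lattice b × lattice E => (1 + ‖(p.1 : Space d)‖) * (1 + ‖(p.2 : Space d)‖) := by
  have h1 : ∀ p : lattice b × lattice E,
      1 ≤ (1 + ‖(p.1 : Space d)‖) * (1 + ‖(p.2 : Space d)‖) := fun p =>
    one_le_mul_of_one_le_of_one_le (le_add_of_nonneg_right (norm_nonneg _))
      (le_add_of_nonneg_right (norm_nonneg _))
  exact (isSummableWeight_lattice b).prod (isSummableWeight_lattice E) h1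
    fun p => le_self_pow₀ (h1 p) two_ne_zero

theorem rapidlyDecreasing_rankOne (b E : Module.Basis (Fin d) ℝ (Space d)) (ψ : 𝓢(Space d, ℂ))
    (hσ : HasCompactSupport σ) (hχ : HasCompactSupport χ) :
    RapidlyDecreasing
      (fun p : lattice b × lattice E => (1 + ‖(p.1 : Space d)‖) * (1 + ‖(p.2 : Space d)‖))
      fun p => rankOne ψ hσ hχ p.1 p.2 := by
  have h1 : RapidlyDecreasing (fun m : lattice b => 1 + ‖(m : Space d)‖) fun m : lattice b =>
      mulComp (tensor σ χ hσ hχ) (ContinuousLinearMap.snd ℝ (Space d) (Space d))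
        (-(m : Space d)) := by
    have := (rapidlyDecreasing_mulComp (tensor σ χ hσ hχ)
      (ContinuousLinearMap.snd ℝ (Space d) (Space d))).reindex fun m : lattice b => -(m : Space d)
    simpa [Function.comp_def] using this
  have h2 : RapidlyDecreasing (fun j : lattice E => 1 + ‖(j : Space d)‖) fun j : lattice E =>
      (partialFourier (-(j : Space d)) : 𝓢(Phase d, ℂ) →L[ℂ] 𝓢(Space d, ℂ)) := by
    have := (rapidlyDecreasing_partialFourier (d := d) (V := Space d)).reindex
      fun j : lattice E => -(j : Space d)
    simpa [Function.comp_def] using this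
  have h3 := h2.comp_prod h1 fun m => by positivity
  set w : lattice b × lattice E → ℝ :=
    fun p => (1 + ‖(p.1 : Space d)‖) * (1 + ‖(p.2 : Space d)‖)
  have hw : ∀ p, 0 ≤ w p := fun p => by positivity
  have h4 : TemperatelyGrowing w fun p : lattice b × lattice E => charMul (p.2 : Space d) :=
    (temperatelyGrowing_charMul.reindex fun p : lattice b × lattice E => (p.2 : Space d)).mono
      (fun p => by simp only [Function.comp_apply]; positivity) zero_le_one fun p => by
        rw [one_mul]
        exact le_mul_of_one_le_left (add_nonneg zero_le_one (norm_nonneg _))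
          (le_add_of_nonneg_right (norm_nonneg _))
  have h5 : TemperatelyGrowing w fun p : lattice b × lattice E =>
      (SchwartzMap.compSubConstCLM ℂ (p.1 : Space d) : 𝓢(Space d, ℂ) →L[ℂ] 𝓢(Space d, ℂ)) :=
    (temperatelyGrowing_compSubConst.reindex fun p : lattice b × lattice E =>
      (p.1 : Space d)).mono (fun p => by simp only [Function.comp_apply]; positivity)
      zero_le_one fun p => by
        rw [one_mul]
        exact le_mul_of_one_le_right (add_nonneg zero_le_one (norm_nonneg _))
          (le_add_of_nonneg_right (norm_nonneg _))
  have h6 := h5.comp_rapid (h4.comp_rapid ((temperatelyGrowing_const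
    ((∫ ξ, ψ ξ)⁻¹ • ContinuousLinearMap.id ℂ 𝓢(Space d, ℂ))).comp_rapid h3 hw) hw) hw
  exact h6

/-- For each `m` the sum over `j` is `σ` times the periodization of `χ f(· + m)`. By `h2` the cutoff
`σ` removes every dual translate but the trivial one, and by `h1` it leaves that one unchanged. The
partition `χ` then sums over `m`. -/
theorem hasSum_rankOne (hχ : IsPartition b χ) (hψ : IsPartition (dual E) ψ)
    (hσ : HasCompactSupport σ) (h1 : ∀ x, χ x ≠ 0 → σ x = 1)
    (h2 : ∀ κ ∈ lattice (dual E), κ ≠ 0 → ∀ x, σ x * χ (x - κ) = 0) (f : 𝓢(Space d, ℂ)) :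
    HasSum (fun p : lattice b × lattice E => rankOne ψ hσ hχ.hasCompactSupport p.1 p.2 f) f := by
  obtain ⟨S, hS⟩ := (rapidlyDecreasing_rankOne b E ψ hσ hχ.hasCompactSupport).exists_sum
    (isSummableWeight_mul b E)
  have h3 : S f = f := by
    ext x
    refine ((hasSum_apply (hS f) x).prod_fiberwise (g := fun m : lattice b => χ (x - m) * f x)
      fun m => ?_).unique ?_
    · set g := mulComp χ (ContinuousLinearMap.id ℝ (Space d)) (-(m : Space d)) f
      have h4 := (hasSum_fourierSeries E ψ g (x - m)).mul_left (σ (x - m))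
      rw [fourierSeries_eq_periodization E hψ] at h4
      have h5 : σ (x - m) * periodization (dual E) g (x - m) = χ (x - m) * f x := by
        have h6 := (hasSum_periodization (dual E) g (x - m)).mul_left (σ (x - m))
        refine h6.unique ?_
        refine (hasSum_ite_eq (0 : lattice (dual E)) (χ (x - m) * f x)).congr_fun fun κ => ?_
        split_ifs with hκ
        · by_cases h : χ (x - m) = 0
          · simp [hκ, g, h]
          · simp [hκ, g, h1 _ h]
        · have := h2 κ κ.2 (fun h => hκ (Subtype.ext h)) (x - m)
          simp only [g, mulComp_apply, ContinuousLinearMap.id_apply]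
          rw [← mul_assoc, this, zero_mul]
      rw [h5] at h4
      exact h4.congr_fun fun j => rankOne_apply ..
    · simpa using (hχ.hasSum x).mul_right (f x)
  have h7 := hS f
  rwa [h3] at h7

end Approximation

/-- The identity of Schwartz functions is a rapidly converging series of operators of rank one. -/
theorem exists_rank_one_series (d : ℕ) : ∃ (b E : Module.Basis (Fin d) ℝ (Space d))
    (A : lattice b × lattice E → 𝓢(Space d, ℂ) →L[ℂ] 𝓢(Space d, ℂ))
    (s : lattice b × lattice E → ℝ),
    IsSummableWeight s ∧ RapidlyDecreasing s A ∧ (∀ f, HasSum (fun p => A p f) f) ∧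
    ∀ p, ∃ a c : 𝓢(Space d, ℂ), ∀ f : 𝓢(Space d, ℂ), A p f = (∫ ξ, a ξ * f ξ) • c := by
  let b := (EuclideanSpace.basisFun (Fin d) ℝ).toBasis
  obtain ⟨χ, hχ⟩ := exists_isPartition b
  obtain ⟨R, hR⟩ := hχ.hasCompactSupport.isBounded.subset_closedBall 0
  have hR' : ∀ x, χ x ≠ 0 → ‖x‖ ≤ R := fun x hx =>
    mem_closedBall_zero_iff.1 (hR (subset_tsupport χ hx))
  obtain ⟨σ, hσ, hσ1, hσR⟩ := exists_schwartz_eq_one (d := d) R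
  -- `χ` lives in radius `R` and `σ` in radius `|R| + 2`, so dual vectors longer than the sum
  -- separate the support of `σ` from the translates of that of `χ`.
  obtain ⟨E, hE⟩ := exists_basis_dual_norm_gt d (|R| + 2 + R)
  obtain ⟨ψ, hψ⟩ := exists_isPartition (dual E)
  refine ⟨b, E, _, _, isSummableWeight_mul b E,
    rapidlyDecreasing_rankOne b E ψ hσ hχ.hasCompactSupport,
    hasSum_rankOne hχ hψ hσ (fun x hx => hσ1 x (hR' x hx)) fun κ hκ h0 x => ?_,
    fun p => exists_eq_smul_rankOne ψ hσ hχ.hasCompactSupport p.1 p.2⟩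
  by_contra h
  have h1 := hσR x (left_ne_zero_of_mul h)
  have h2 := hR' _ (right_ne_zero_of_mul h)
  have h3 := hE κ hκ h0
  have h4 : ‖κ‖ ≤ ‖x‖ + ‖x - κ‖ := by
    simpa using norm_sub_le x (x - κ)
  linarith

theorem integrable_mul_schwartz (a f : 𝓢(Space d, ℂ)) : Integrable fun x => a x * f x := by
  refine ((mulComp a (ContinuousLinearMap.id ℝ (Space d)) 0 f).integrable
    (μ := volume)).congr (Filter.Eventually.of_forall fun x => ?_)
  simp

/-! ### Density of Schwartz functions in the space of tempered distributions -/

theorem exists_seminorm_bound (u : 𝓢(Space d, ℂ) →L[ℂ] ℂ) : ∃ (J : Finset (ℕ × ℕ)) (C : ℝ),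
    0 ≤ C ∧ ∀ f, ‖u f‖ ≤ C * J.sup (schwartzSeminormFamily ℂ (Space d) ℂ) f := by
  obtain ⟨J, C, -, h⟩ := Seminorm.bound_of_continuous (schwartz_withSeminorms ℂ (Space d) ℂ)
    ((normSeminorm ℂ ℂ).comp u.toLinearMap) u.continuous.norm
  exact ⟨J, C, C.2, h⟩

theorem exists_isGivenBy_sum {ι : Type*} (t : Finset ι) (u : ι → 𝓢(Space d, ℂ) → ℂ)
    (hu : ∀ i, ∃ a : 𝓢(Space d, ℂ), IsGivenBy (u i) a) :
    ∃ a : 𝓢(Space d, ℂ), IsGivenBy (fun f => ∑ i ∈ t, u i f) a := by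
  choose a ha using hu
  have h1 : ∀ x, (∑ i ∈ t, a i : 𝓢(Space d, ℂ)) x = ∑ i ∈ t, a i x := fun x => by
    simp
  refine ⟨∑ i ∈ t, a i, fun f => ⟨integrable_mul_schwartz _ f, ?_⟩⟩
  simp only [h1, Finset.sum_mul]
  rw [integral_finsetSum _ fun i _ => (ha i f).1]
  exact Finset.sum_congr rfl fun i _ => (ha i f).2

/-- A tempered distribution is a limit, uniformly on bounded sets, of Schwartz functions. -/
theorem exists_tendstoUniformlyOn (u : 𝓢(Space d, ℂ) →L[ℂ] ℂ) :
    ∃ (ι : Type) (U : Finset ι → 𝓢(Space d, ℂ) →L[ℂ] ℂ),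
      (∀ t, ∃ a : 𝓢(Space d, ℂ), IsGivenBy (U t) a) ∧
      ∀ B : Set 𝓢(Space d, ℂ), Bornology.IsVonNBounded ℂ B →
        TendstoUniformlyOn (fun t f => U t f) u Filter.atTop B := by
  obtain ⟨b, E, A, s, hs, hA, hsum, hrank⟩ := exists_rank_one_series d
  refine ⟨_, fun t => ∑ p ∈ t, u.comp (A p), fun t => ?_, fun B hB => ?_⟩
  · obtain ⟨a, ha⟩ := exists_isGivenBy_sum t (fun p f => u (A p f)) fun p => by
      obtain ⟨a, c, hac⟩ := hrank p
      -- Applying `u` to `(∫ a f) c` gives `∫ u(c) a f`.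
      refine ⟨u c • a, fun f => ⟨integrable_mul_schwartz _ f, ?_⟩⟩
      change u (A p f) = _
      rw [hac, map_smul, smul_eq_mul, mul_comm, ← integral_const_mul]
      simp [mul_assoc]
    exact ⟨a, fun f => by simpa using ha f⟩
  · obtain ⟨J, C, hC, hu⟩ := exists_seminorm_bound u
    choose I β hβ hβ0 hAβ using hA.exists_summable_bound hs
    choose r hr0 hr using fun I =>
      (schwartz_withSeminorms ℂ (Space d) ℂ).isVonNBounded_iff_finset_seminorm_bounded.1 hB I
    have h1 : TendstoUniformlyOn (fun (t : Finset (lattice b × lattice E)) f =>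
        ∑ p ∈ t, u (A p f)) (fun f => ∑' p, u (A p f)) Filter.atTop B := by
      -- Weierstrass test: seminorms are bounded on `B` by constants `r`, and the operator bounds
      -- `β` are summable in `p`.
      refine tendstoUniformlyOn_tsum (u := fun p => C * ∑ i ∈ J, β i.1 i.2 p * r (I i.1 i.2))
        ((summable_sum fun i _ => (hβ i.1 i.2).mul_right _).mul_left C) fun p f hf => ?_
      refine (hu _).trans (mul_le_mul_of_nonneg_left ?_ hC)
      refine (Seminorm.finset_sup_le_sum _ J _).trans ?_
      rw [FunLike.coe_sum, Finset.sum_apply]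
      exact Finset.sum_le_sum fun i _ => (hAβ i.1 i.2 p f).trans
        (mul_le_mul_of_nonneg_left (hr _ f hf).le (hβ0 _ _ _))
    have h2 : (fun f => ∑' p, u (A p f)) = u := funext fun f =>
      ((hsum f).mapL u).tsum_eq
    rw [h2] at h1
    simpa using h1

end

/-! ### The Zak transform of tempered distributions and its uniqueness -/

section

variable {d : ℕ} {E : Module.Basis (Fin d) ℝ (Space d)} {χ ψ : 𝓢(Space d, ℂ)}

theorem IsGivenBy.unique {W : Type*} [NormedAddCommGroup W] [NormedSpace ℝ W] [MeasureSpace W]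
    {u v : 𝓢(W, ℂ) → ℂ} {g : W → ℂ} (hu : IsGivenBy u g) (hv : IsGivenBy v g) : u = v :=
  funext fun Φ => (hu Φ).2.trans (hv Φ).2.symm

/-- The Zak transform of tempered distributions, for the weak-star topologies. -/
def zakWeak (hχ : IsPartition E χ) (hψ : IsPartition (dual E) ψ) :
    𝓢'(Space d, ℂ) ≃L[ℂ] quasiPeriodicWeak E :=
  ContinuousLinearEquiv.equivOfInverse
    ((PointwiseConvergenceCLM.precomp ℂ (transposeZak E)).codRestrict (quasiPeriodicWeak E)
      fun u => isQuasiPeriodicFunctional_comp_transposeZak E u)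
    ((PointwiseConvergenceCLM.precomp ℂ (transposeLift hχ hψ)).comp
      (quasiPeriodicWeak E).subtypeL)
    (fun u => DFunLike.ext _ _ fun f =>
      congrArg u (transposeZak_transposeLift hχ hψ f))
    (fun u => Subtype.ext <| DFunLike.ext _ _ fun Φ =>
      transposeLift_transposeZak hχ hψ u.1 u.2 Φ)

/-- The Zak transform of tempered distributions, for the strong dual topologies. -/
def zakStrong (hχ : IsPartition E χ) (hψ : IsPartition (dual E) ψ) :
    StrongDual ℂ 𝓢(Space d, ℂ) ≃L[ℂ] quasiPeriodicStrong E :=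
  ContinuousLinearEquiv.equivOfInverse
    ((ContinuousLinearMap.precomp ℂ (transposeZak E)).codRestrict (quasiPeriodicStrong E)
      fun u => isQuasiPeriodicFunctional_comp_transposeZak E u)
    ((ContinuousLinearMap.precomp ℂ (transposeLift hχ hψ)).comp
      (quasiPeriodicStrong E).subtypeL)
    (fun u => ContinuousLinearMap.ext fun f =>
      congrArg u (transposeZak_transposeLift hχ hψ f))
    (fun u => Subtype.ext <| ContinuousLinearMap.ext fun Φ =>
      transposeLift_transposeZak hχ hψ u.1 u.2 Φ)

/-- Schwartz functions are dense in the strong dual. -/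
theorem exists_tendsto_strong (u : StrongDual ℂ 𝓢(Space d, ℂ)) :
    ∃ (ι : Type) (U : Finset ι → StrongDual ℂ 𝓢(Space d, ℂ)),
      (∀ t, ∃ a : 𝓢(Space d, ℂ), IsGivenBy (U t) a) ∧
      Filter.Tendsto U Filter.atTop (nhds u) := by
  obtain ⟨ι, U, hU, h⟩ := exists_tendstoUniformlyOn u
  exact ⟨ι, U, hU, (UniformConvergenceCLM.tendsto_iff_tendstoUniformlyOn (RingHom.id ℂ) ℂ _).2 h⟩

/-- Schwartz functions are dense in the weak-star dual. -/
theorem exists_tendsto_weak (u : 𝓢'(Space d, ℂ)) :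
    ∃ (ι : Type) (U : Finset ι → 𝓢'(Space d, ℂ)),
      (∀ t, ∃ a : 𝓢(Space d, ℂ), IsGivenBy (U t) a) ∧
      Filter.Tendsto U Filter.atTop (nhds u) := by
  let P := ContinuousLinearMap.toPointwiseConvergenceCLM ℂ (RingHom.id ℂ) 𝓢(Space d, ℂ) ℂ
  let v : StrongDual ℂ 𝓢(Space d, ℂ) := ⟨u.toLinearMap, u.cont⟩
  have hv : P v = u := rfl
  obtain ⟨ι, U, hU, h⟩ := exists_tendsto_strong v
  refine ⟨ι, fun t => P (U t), hU, ?_⟩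
  rw [← hv]
  exact (P.continuous.tendsto v).comp h

/-- Two continuous maps that agree on a dense set agree; linearity of `G` plays no role. -/
theorem zakWeak_unique (hχ : IsPartition E χ) (hψ : IsPartition (dual E) ψ)
    {G : 𝓢'(Space d, ℂ) → 𝓢'(Phase d, ℂ)} (hG : Continuous G)
    (h : ∀ (f : 𝓢(Space d, ℂ)) (u : 𝓢'(Space d, ℂ)), IsGivenBy u f →
      IsGivenBy (G u) (zak E f)) (u : 𝓢'(Space d, ℂ)) : G u = (zakWeak hχ hψ u).1 := by
  obtain ⟨ι, U, hU, h1⟩ := exists_tendsto_weak u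
  refine tendsto_nhds_unique ((hG.tendsto u).comp h1) ?_
  refine (((continuous_subtype_val.comp (zakWeak hχ hψ).continuous).tendsto u).comp h1).congr
    fun t => ?_
  obtain ⟨a, ha⟩ := hU t
  exact DFunLike.coe_injective ((isGivenBy_comp_transposeZak E a (U t) ha).unique (h a _ ha))

theorem zakStrong_unique (hχ : IsPartition E χ) (hψ : IsPartition (dual E) ψ)
    {G : StrongDual ℂ 𝓢(Space d, ℂ) → StrongDual ℂ 𝓢(Phase d, ℂ)} (hG : Continuous G)
    (h : ∀ (f : 𝓢(Space d, ℂ)) (u : StrongDual ℂ 𝓢(Space d, ℂ)), IsGivenBy u f →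
      IsGivenBy (G u) (zak E f)) (u : StrongDual ℂ 𝓢(Space d, ℂ)) :
    G u = (zakStrong hχ hψ u).1 := by
  obtain ⟨ι, U, hU, h1⟩ := exists_tendsto_strong u
  refine tendsto_nhds_unique ((hG.tendsto u).comp h1) ?_
  refine (((continuous_subtype_val.comp (zakStrong hχ hψ).continuous).tendsto u).comp h1).congr
    fun t => ?_
  obtain ⟨a, ha⟩ := hU t
  exact DFunLike.coe_injective ((isGivenBy_comp_transposeZak E a (U t) ha).unique (h a _ ha))

end

end ZakTransform
end

theorem theorem3p1 (d : ℕ) (E : Module.Basis (Fin d) ℝ (ZakTransform.Space d)) :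
    -- the series that defines the Zak transform converges absolutely
    (∀ (f : 𝓢(ZakTransform.Space d, ℂ)) (x ξ : ZakTransform.Space d),
      Summable fun j : ZakTransform.lattice E => ZakTransform.zakTerm f x ξ j) ∧
    -- it is a homeomorphism from Schwartz functions onto quasi-periodic smooth functions
    (∃ Z : 𝓢(ZakTransform.Space d, ℂ) ≃ₜ ZakTransform.QuasiPeriodicSmooth E,
      ∀ (f : 𝓢(ZakTransform.Space d, ℂ)) (p : ZakTransform.Phase d),
        (Z f).1 p = ZakTransform.zak E f p) ∧
    -- unique extension to tempered distributions, weak-star topologies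
    (∃ T : 𝓢'(ZakTransform.Space d, ℂ) ≃L[ℂ] ZakTransform.quasiPeriodicWeak E,
      (∀ (f : 𝓢(ZakTransform.Space d, ℂ)) (u : 𝓢'(ZakTransform.Space d, ℂ)),
        ZakTransform.IsGivenBy u f → ZakTransform.IsGivenBy (T u).1 (ZakTransform.zak E f)) ∧
      ∀ G : 𝓢'(ZakTransform.Space d, ℂ) → 𝓢'(ZakTransform.Phase d, ℂ), Continuous G →
        (∀ (f : 𝓢(ZakTransform.Space d, ℂ)) (u : 𝓢'(ZakTransform.Space d, ℂ)),
          ZakTransform.IsGivenBy u f → ZakTransform.IsGivenBy (G u) (ZakTransform.zak E f)) →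
        ∀ u, G u = (T u).1) ∧
    -- unique extension to tempered distributions, strong dual topologies
    (∃ T : StrongDual ℂ 𝓢(ZakTransform.Space d, ℂ) ≃L[ℂ] ZakTransform.quasiPeriodicStrong E,
      (∀ (f : 𝓢(ZakTransform.Space d, ℂ)) (u : StrongDual ℂ 𝓢(ZakTransform.Space d, ℂ)),
        ZakTransform.IsGivenBy u f → ZakTransform.IsGivenBy (T u).1 (ZakTransform.zak E f)) ∧
      ∀ G : StrongDual ℂ 𝓢(ZakTransform.Space d, ℂ) → StrongDual ℂ 𝓢(ZakTransform.Phase d, ℂ),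
        Continuous G →
        (∀ (f : 𝓢(ZakTransform.Space d, ℂ)) (u : StrongDual ℂ 𝓢(ZakTransform.Space d, ℂ)),
          ZakTransform.IsGivenBy u f → ZakTransform.IsGivenBy (G u) (ZakTransform.zak E f)) →
        ∀ u, G u = (T u).1) := by
  -- The choice of `χ` and `ψ` enters only the formulas for the inverses, not the transforms.
  obtain ⟨χ, hχ⟩ := ZakTransform.exists_isPartition E
  obtain ⟨ψ, hψ⟩ := ZakTransform.exists_isPartition (ZakTransform.dual E)
  refine ⟨fun f x ξ => (ZakTransform.hasSum_zak E f (x, ξ)).summable,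
    ⟨ZakTransform.zakHomeomorph hχ hψ, fun _ _ => rfl⟩,
    ⟨ZakTransform.zakWeak hχ hψ,
      fun f u hu => ZakTransform.isGivenBy_comp_transposeZak E f u hu,
      fun G hG h => ZakTransform.zakWeak_unique hχ hψ hG h⟩,
    ⟨ZakTransform.zakStrong hχ hψ,
      fun f u hu => ZakTransform.isGivenBy_comp_transposeZak E f u hu,
      fun G hG h => ZakTransform.zakStrong_unique hχ hψ hG h⟩⟩
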